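/- Let $1\le T_0<T$ and $n\ge 4T$ be integers and let $\mu,s>0$. Let $X=M+E$ be a random $n\times T$ donor matrix, where $M$ is a deterministic real matrix of rank $r<T$ and the entries of $E$ are independent $\mathcal N(0,s^2)$ variables. Let $A$ be the sub-matrix of $X$ formed by the rows in a measurable, possibly random and data-dependent, set $C\subseteq\{1,\dots,n\}$ (in particular, the rows in the donor cluster selected by ClusterSC), put $n_A=|C|$, and let $S$ be the sub-matrix of $M$ with the same rows and $r_S=\operatorname{rank}(S)$. Write $\sigma_j(\cdot)$ for the $j$-th largest singular value ($\sigma_j=0$ when $j$ exceeds the number of rows or columns) and $\sigma^*_X=\sigma_{r+1}(X)$, $\sigma^*_A=\sigma_{r_S+1}(A)$. The upper bound on the pre-intervention mean squared error of the synthetic control estimator (hard singular value thresholding followed by least squares, $T_0$ pre-intervention times, ideal weights of norm at most $\mu$) on the full donor pool $X$ is $$U_X=\frac{\mu^2}{T_0}\,\mathbb E\Big[\big(\sigma^*_X+2s(\sqrt n+\sqrt T)\big)^2\Big]+\frac{2s^2r}{T_0},$$ and the corresponding bound for ClusterSC, which uses only the sub-pool $A$, is $$U_A=\frac{\mu^2}{T_0}\,\mathbb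 E\Big[\big(\sigma^*_A+2s(\sqrt{n_A}+\sqrt T)\big)^2\Big]+\frac{2s^2\,\mathbb E[r_S]}{T_0}.$$ Suppose that $n_A<n+4T-4\sqrt{nT}$ almost surely. Then both expectations of squares are finite and $$U_A<U_X .$$ Moreover the gap is $\Omega(s^2n)$ in the following sense: there is an absolute constant $c>0$ (independent of $n,T,T_0,\mu,s,M$ and $C$) such that, for every $\alpha\in(0,1)$ with $n_A\le\alpha^2 n$ almost surely, $$U_X-U_A\ \ge\ c\,(1-\alpha)\,\frac{\mu^2}{T_0}\,s^2 n .$$ -/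

import Mathlib

open MeasureTheory ProbabilityTheory

namespace ClusterSC

noncomputable section

/-- The sub-matrix of `X` formed by the rows (donor units) in `C`. -/
def subPool {n T : ℕ} (C : Finset (Fin n)) (X : Matrix (Fin n) (Fin T) ℝ) :
    Matrix C (Fin T) ℝ :=
  X.submatrix (fun i : C => (i : Fin n)) id

/-- For a donor matrix `Z` with signal part `S`: the singular value `σ_{rank S + 1}(Z)`, the largest
one that is removed by hard singular value thresholding at the approximate rank `rank S`.
(Mathlib numbers singular values decreasingly from `0`, with multiplicity.) -/
def sigmaStar {ι : Type*} [Fintype ι] {T : ℕ} (S Z : Matrix ι (Fin T) ℝ) : ℝ :=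
  (Matrix.toEuclideanLin Z).singularValues S.rank

/-- `(σ* + 2 s (√N + √T))²` for a donor matrix `Z` with `N` rows, `T` columns and signal part `S`. -/
def sqTerm {ι : Type*} [Fintype ι] {T : ℕ} (s : ℝ) (S Z : Matrix ι (Fin T) ℝ) : ℝ :=
  (sigmaStar S Z + 2 * s * (√(Fintype.card ι : ℝ) + √(T : ℝ))) ^ 2

/-- The upper bound on the pre-intervention MSE of synthetic control on the full donor pool
`X = M + E`, namely `(μ² / T₀) 𝔼[(σ*_X + 2 s (√n + √T))²] + 2 s² r / T₀` with `r = rank M`. -/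
def scBound {Ω : Type*} [MeasurableSpace Ω] (P : Measure Ω) {n T : ℕ} (T₀ : ℕ) (μ s : ℝ)
    (M : Matrix (Fin n) (Fin T) ℝ) (E : Ω → Matrix (Fin n) (Fin T) ℝ) : ℝ :=
  μ ^ 2 / T₀ * (∫ ω, sqTerm s M (M + E ω) ∂P) + 2 * s ^ 2 * (M.rank : ℝ) / T₀

/-- The same bound when the donor pool is the sub-pool `A = S + E_S` formed by the rows in `C`:
`σ*_X`, `n`, `r` become `σ*_A = σ_{r_S + 1}(A)`, `n_A = #C` and `r_S = rank S`. The selection may be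
random (it is computed from the noisy data), so the expectation is also taken over `n_A` and
`r_S`; for a non-random `C` it is literally the bound above, written for `A`. -/
def clusterBound {Ω : Type*} [MeasurableSpace Ω] (P : Measure Ω) {n T : ℕ} (T₀ : ℕ) (μ s : ℝ)
    (M : Matrix (Fin n) (Fin T) ℝ) (E : Ω → Matrix (Fin n) (Fin T) ℝ)
    (C : Ω → Finset (Fin n)) : ℝ :=
  μ ^ 2 / T₀ * (∫ ω, sqTerm s (subPool (C ω) M) (subPool (C ω) (M + E ω)) ∂P)
    + 2 * s ^ 2 * (∫ ω, ((subPool (C ω) M).rank : ℝ) ∂P) / T₀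

end

end ClusterSC

/-!
Write `t = √T`, `y = √n`, and normalise to `s = 1`. The hypothesis on `n_A` says exactly that
`√n_A < √n - 2 √T`, so the deterministic terms `2 (√n + √T)` and `2 (√n_A + √T)` differ by more than
`4 √T`. It remains to see that the singular values cannot make up for that.

For every selection `C`, even a data-dependent one, Weyl's inequality bounds `σ*_A` by `‖E w‖` for
some unit vector `w`, because `σ_{rank S + 1}(S) = 0`. If `W` has orthonormal rows spanning the
orthogonal complement of the column space of `M`, then `σ*_X = ‖X u‖ ≥ ‖W X u‖ = ‖W E u‖` for some
unit vector `u`, and `W E` is a standard Gaussian matrix with `n - rank M > n - T` rows. So what is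
needed is control, in the mean, of `‖F u‖` uniformly over unit vectors `u` for a standard Gaussian
matrix `F`: an upper bound `(√n + 4/3 √T)²` for the mean of the supremum of the square
(`exists_hasMean_sqNorm_le`), and a lower bound `√n - 2.6 √T` for the mean of the infimum
(`exists_hasMean_le_sigmaStar`, from `exists_hasMean_le_sqrt_sqNorm`). As `4/3 + 2.6 < 4`, the gap
of the deterministic terms wins with room to spare, and `integrable_and_gap` turns this into the
comparison of the mean squares. The rank terms only help, as `rank S ≤ rank M`.

The uniform bounds avoid Gaussian comparison inequalities by an entropy (PAC-Bayes) argument. The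
quantity `partition l F` averages `exp (l ‖F θ‖²)` over random directions `θ`. For a fixed direction
`F θ` is a standard Gaussian vector, so the mean of `partition l F` over `F` is the chi-square
exponential moment `(1 - 2 l)^(-n/2)` (`integral_partition`). Conversely the Gibbs variational
principle, with directions concentrated around a given unit vector `u`, gives
`exp (l (3/4 ‖F u‖² + 1/4 ‖F‖² / T) - K) ≤ partition l F` for all `u` at once, where
`K = T log 2 + 3/16` (`exp_le_partition`). A positive `l` of order `√(T/n)` yields the upper bound,
a negative one the lower bound; the Frobenius norm `‖F‖² / T` concentrates at `n`.

The unit vectors `u`, `w` depend on the noise, and nothing is known about their measurability; so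
each uniform bound is stated as an explicit integrable function of the noise with a known mean
(`HasMean`) that bounds `‖F u‖` or its square for all `u` pointwise.
-/

open MeasureTheory ProbabilityTheory

namespace ClusterSC

/-! ### Singular values -/

section SingularValues

variable {E F F' : Type*} [NormedAddCommGroup E] [InnerProductSpace ℝ E] [FiniteDimensional ℝ E]
  [NormedAddCommGroup F] [InnerProductSpace ℝ F] [FiniteDimensional ℝ F]
  [NormedAddCommGroup F'] [InnerProductSpace ℝ F'] [FiniteDimensional ℝ F']

lemma norm_sq_eq_sum_singularValues (A : E →ₗ[ℝ] F) (w : E) :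
    ‖A w‖ ^ 2 = ∑ i : Fin (Module.finrank ℝ E), A.singularValues i ^ 2 *
      (inner ℝ (A.isSymmetric_adjoint_comp_self.eigenvectorBasis rfl i) w) ^ 2 := by
  set b := A.isSymmetric_adjoint_comp_self.eigenvectorBasis rfl with hb
  have h1 : ‖A w‖ ^ 2 = inner ℝ ((A.adjoint ∘ₗ A) w) w := by
    rw [← real_inner_self_eq_norm_sq, LinearMap.comp_apply, LinearMap.adjoint_inner_left]
  rw [h1, ← b.sum_inner_mul_inner]
  refine Finset.sum_congr rfl fun i _ => ?_
  rw [A.isSymmetric_adjoint_comp_self w (b i), hb,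
    LinearMap.IsSymmetric.apply_eigenvectorBasis, A.sq_singularValues_fin rfl, inner_smul_right,
    real_inner_comm w, sq, ← mul_assoc]
  rfl

lemma norm_sq_eq_sum_eigenvectorBasis (A : E →ₗ[ℝ] F) (w : E) :
    ‖w‖ ^ 2 = ∑ i : Fin (Module.finrank ℝ E),
      (inner ℝ (A.isSymmetric_adjoint_comp_self.eigenvectorBasis rfl i) w) ^ 2 :=
  (OrthonormalBasis.sum_sq_inner_right _ w).symm

/-- The min-max principle in the form used for comparing two maps: the span of the top `k + 1`
right singular vectors of `A` meets the span of the right singular vectors of `B` of index `≥ k`. -/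
lemma exists_unit_singularValues_le (A : E →ₗ[ℝ] F) (B : E →ₗ[ℝ] F') {k : ℕ}
    (hk : k < Module.finrank ℝ E) :
    ∃ w : E, ‖w‖ = 1 ∧ A.singularValues k ≤ ‖A w‖ ∧ ‖B w‖ ≤ B.singularValues k := by
  set b := A.isSymmetric_adjoint_comp_self.eigenvectorBasis rfl with hb
  set c := B.isSymmetric_adjoint_comp_self.eigenvectorBasis rfl with hc
  let Φ : E →ₗ[ℝ] (Fin (Module.finrank ℝ E) → ℝ) := LinearMap.pi fun i =>
    if (i : ℕ) < k then (innerₛₗ ℝ (c i)) else if k < (i : ℕ) then (innerₛₗ ℝ (b i)) else 0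
  have hns : ¬ Function.Surjective Φ := by
    intro hs
    obtain ⟨v, hv⟩ := hs (Pi.single ⟨k, hk⟩ 1)
    have := congrFun hv ⟨k, hk⟩
    simp [Φ] at this
  have hni : ¬ Function.Injective Φ := fun h =>
    hns ((LinearMap.injective_iff_surjective_of_finrank_eq_finrank (by simp)).1 h)
  have hker : LinearMap.ker Φ ≠ ⊥ := fun h => hni (LinearMap.ker_eq_bot.1 h)
  obtain ⟨v, hv, hv0⟩ := Submodule.exists_mem_ne_zero_of_ne_bot hker
  have hvn : ‖v‖ ≠ 0 := norm_ne_zero_iff.2 hv0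
  obtain ⟨w, hw, hw1⟩ : ∃ w ∈ LinearMap.ker Φ, ‖w‖ = 1 :=
    ⟨‖v‖⁻¹ • v, Submodule.smul_mem _ _ hv, by rw [norm_smul, norm_inv, norm_norm,
      inv_mul_cancel₀ hvn]⟩
  have hΦ : ∀ i, Φ w i = 0 := fun i => congrFun (LinearMap.mem_ker.1 hw) i
  have hbw : ∀ i : Fin (Module.finrank ℝ E), k < (i : ℕ) → inner ℝ (b i) w = 0 := by
    intro i hi
    simpa [Φ, not_lt.2 hi.le, hi] using hΦ i
  have hcw : ∀ i : Fin (Module.finrank ℝ E), (i : ℕ) < k → inner ℝ (c i) w = 0 := by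
    intro i hi
    simpa [Φ, hi] using hΦ i
  refine ⟨w, hw1, ?_, ?_⟩
  · refine le_of_sq_le_sq ?_ (norm_nonneg _)
    rw [norm_sq_eq_sum_singularValues, ← mul_one (_ ^ 2), ← one_pow (M := ℝ) 2, ← hw1,
      norm_sq_eq_sum_eigenvectorBasis A w, Finset.mul_sum]
    refine Finset.sum_le_sum fun i _ => ?_
    by_cases hi : k < (i : ℕ)
    · simp [← hb, hbw i hi]
    · have := A.singularValues_antitone (not_lt.1 hi)
      have := A.singularValues_nonneg k
      gcongr
  · refine le_of_sq_le_sq ?_ (B.singularValues_nonneg k)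
    rw [norm_sq_eq_sum_singularValues, ← mul_one (_ ^ 2), ← one_pow (M := ℝ) 2, ← hw1,
      norm_sq_eq_sum_eigenvectorBasis B w, Finset.mul_sum]
    refine Finset.sum_le_sum fun i _ => ?_
    by_cases hi : (i : ℕ) < k
    · simp [← hc, hcw i hi]
    · have := B.singularValues_antitone (not_lt.1 hi)
      have := B.singularValues_nonneg i
      gcongr

/-- Weyl's inequality for the difference of two maps. -/
lemma abs_singularValues_sub_le (A B : E →L[ℝ] F) {k : ℕ} (hk : k < Module.finrank ℝ E) :
    |(A : E →ₗ[ℝ] F).singularValues k - (B : E →ₗ[ℝ] F).singularValues k| ≤ ‖A - B‖ := by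
  have key : ∀ A B : E →L[ℝ] F, (A : E →ₗ[ℝ] F).singularValues k
      - (B : E →ₗ[ℝ] F).singularValues k ≤ ‖A - B‖ := by
    intro A B
    obtain ⟨w, hw, h1, h2⟩ := exists_unit_singularValues_le (A : E →ₗ[ℝ] F) (B : E →ₗ[ℝ] F) hk
    have h3 : ‖(A - B) w‖ ≤ ‖A - B‖ := by simpa [hw] using (A - B).le_opNorm w
    have h4 : ‖A w‖ - ‖B w‖ ≤ ‖(A - B) w‖ := by
      simpa using norm_sub_norm_le (A w) (B w)
    simp only [ContinuousLinearMap.coe_coe] at h1 h2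
    linarith
  rw [abs_sub_le_iff]
  exact ⟨key A B, by rw [norm_sub_rev]; exact key B A⟩

end SingularValues

/-- The range of `toEuclideanLin S` has the dimension `S.rank`. -/
lemma finrank_range_toEuclideanLin {ι : Type*} [Fintype ι] {T : ℕ} (S : Matrix ι (Fin T) ℝ) :
    Module.finrank ℝ (LinearMap.range (Matrix.toEuclideanLin S)) = S.rank := by
  classical
  rw [Matrix.toEuclideanLin_eq_toLin_orthonormal]
  exact (S.rank_eq_finrank_range_toLin _ _).symm

lemma continuous_sigmaStar {ι : Type*} [Fintype ι] {T : ℕ} (S : Matrix ι (Fin T) ℝ)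
    (hS : S.rank < T) : Continuous fun Z : Matrix ι (Fin T) ℝ => sigmaStar S Z := by
  let L : Matrix ι (Fin T) ℝ →ₗ[ℝ] (EuclideanSpace ℝ (Fin T) →L[ℝ] EuclideanSpace ℝ ι) :=
    LinearMap.toContinuousLinearMap.toLinearMap ∘ₗ Matrix.toEuclideanLin.toLinearMap
  have hL : Continuous L := L.continuous_of_finiteDimensional
  have hk : S.rank < Module.finrank ℝ (EuclideanSpace ℝ (Fin T)) := by simpa using hS
  have h1 : LipschitzWith 1 fun A : EuclideanSpace ℝ (Fin T) →L[ℝ] EuclideanSpace ℝ ι =>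
      (A : EuclideanSpace ℝ (Fin T) →ₗ[ℝ] EuclideanSpace ℝ ι).singularValues S.rank := by
    refine LipschitzWith.of_dist_le_mul fun A B => ?_
    rw [Real.dist_eq, dist_eq_norm, NNReal.coe_one, one_mul]
    exact abs_singularValues_sub_le A B hk
  refine (h1.continuous.comp hL).congr fun Z => ?_
  have : ((L Z : EuclideanSpace ℝ (Fin T) →L[ℝ] EuclideanSpace ℝ ι) :
      EuclideanSpace ℝ (Fin T) →ₗ[ℝ] EuclideanSpace ℝ ι) = Matrix.toEuclideanLin Z := by
    ext v
    simp [L]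
  simp only [Function.comp_apply, sigmaStar, this]

lemma sigmaStar_nonneg {ι : Type*} [Fintype ι] {T : ℕ} (S Z : Matrix ι (Fin T) ℝ) :
    0 ≤ sigmaStar S Z := LinearMap.singularValues_nonneg _ _

/-- `σ_{rank S + 1}(Z)` is attained at a unit vector. -/
lemma exists_norm_eq_sigmaStar {ι : Type*} [Fintype ι] {T : ℕ} (S Z : Matrix ι (Fin T) ℝ)
    (hS : S.rank < T) : ∃ u : EuclideanSpace ℝ (Fin T), ‖u‖ = 1 ∧
      ‖Matrix.toEuclideanLin Z u‖ = sigmaStar S Z := by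
  obtain ⟨w, hw, h1, h2⟩ := exists_unit_singularValues_le (Matrix.toEuclideanLin Z)
    (Matrix.toEuclideanLin Z) (k := S.rank) (by simpa using hS)
  exact ⟨w, hw, le_antisymm h2 h1⟩

/-- Since `σ_{rank S + 1}(S) = 0`, the value `σ_{rank S + 1}(S + N)` is at most `‖N w‖` for some
unit vector `w`. -/
lemma exists_sigmaStar_add_le {ι : Type*} [Fintype ι] {T : ℕ} (S N : Matrix ι (Fin T) ℝ)
    (hS : S.rank < T) : ∃ w : EuclideanSpace ℝ (Fin T), ‖w‖ = 1 ∧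
      sigmaStar S (S + N) ≤ ‖Matrix.toEuclideanLin N w‖ := by
  obtain ⟨w, hw, h1, h2⟩ := exists_unit_singularValues_le (Matrix.toEuclideanLin (S + N))
    (Matrix.toEuclideanLin S) (k := S.rank) (by simpa using hS)
  have h3 : (Matrix.toEuclideanLin S).singularValues S.rank = 0 := by
    rw [LinearMap.singularValues_eq_zero_iff_le_finrank_range, finrank_range_toEuclideanLin]
  rw [h3] at h2
  have h4 : Matrix.toEuclideanLin S w = 0 := norm_le_zero_iff.1 h2
  refine ⟨w, hw, ?_⟩
  simpa [h4, sigmaStar] using h1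

/-! ### Moments of the standard Gaussian measure and orthonormal images -/

/-- The standard Gaussian measure on `ι → ℝ`: the coordinates are independent and `N(0, 1)`. -/
noncomputable abbrev stdGauss (ι : Type*) [Fintype ι] : Measure (ι → ℝ) :=
  Measure.pi fun _ => gaussianReal 0 1

section OneDim

lemma gaussianPDFReal_std (x : ℝ) :
    gaussianPDFReal 0 1 x = (√(2 * Real.pi))⁻¹ * Real.exp (-(1 / 2) * x ^ 2) := by
  rw [gaussianPDFReal_def]
  simp only [NNReal.coe_one, mul_one, sub_zero]
  ring_nf

lemma integral_std (f : ℝ → ℝ) : ∫ x, f x ∂(gaussianReal 0 1) =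
    (√(2 * Real.pi))⁻¹ * ∫ x, f x * Real.exp (-(1 / 2) * x ^ 2) := by
  rw [integral_gaussianReal_eq_integral_smul one_ne_zero, ← integral_const_mul]
  congr with x
  rw [gaussianPDFReal_std, smul_eq_mul]
  ring

lemma integral_exp_sq_std {l : ℝ} (hl : l < 1 / 2) :
    ∫ x, Real.exp (l * x ^ 2) ∂(gaussianReal 0 1) = (√(1 - 2 * l))⁻¹ := by
  have h1 : 0 < 1 - 2 * l := by linarith
  rw [integral_std]
  have : ∀ x : ℝ, Real.exp (l * x ^ 2) * Real.exp (-(1 / 2) * x ^ 2)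
      = Real.exp (-(1 / 2 - l) * x ^ 2) := fun x => by rw [← Real.exp_add]; ring_nf
  simp_rw [this]
  rw [integral_gaussian, ← Real.sqrt_inv, ← Real.sqrt_inv, ← Real.sqrt_mul (by positivity)]
  congr 1
  have := Real.pi_pos
  rw [show (1 : ℝ) / 2 - l = (1 - 2 * l) / 2 by ring]
  field_simp

lemma integrable_pow_std (k : ℕ) : Integrable (fun x : ℝ => x ^ k) (gaussianReal 0 1) := by
  have h := (memLp_id_gaussianReal' (μ := 0) (v := 1) (k : ENNReal) (by simp)).integrable_norm_pow'
  refine h.mono' (by fun_prop) (Filter.Eventually.of_forall fun x => by simp)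

lemma integral_sq_std : ∫ x, x ^ 2 ∂(gaussianReal 0 1) = 1 := by
  have h := variance_fun_id_gaussianReal (μ := 0) (v := 1)
  rw [variance_of_integral_eq_zero (by fun_prop) (by simp [integral_id_gaussianReal])] at h
  simpa using h

lemma integral_pow_four_std : ∫ x, x ^ 4 ∂(gaussianReal 0 1) = 3 := by
  rw [integral_std]
  have h1 : ∫ x : ℝ, x ^ 4 * Real.exp (-(1 / 2) * x ^ 2) =
      2 * ∫ x in Set.Ioi (0 : ℝ), x ^ (4 : ℝ) * Real.exp (-(1 / 2) * x ^ (2 : ℝ)) := by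
    rw [← integral_comp_abs]
    congr with x
    norm_cast
    rw [sq_abs, pow_abs, abs_of_nonneg (by positivity : (0 : ℝ) ≤ x ^ 4)]
  rw [h1, integral_rpow_mul_exp_neg_mul_rpow (by norm_num) (by norm_num) (by norm_num)]
  have h2 : Real.Gamma ((4 + 1) / 2) = 3 / 4 * √Real.pi := by
    rw [show ((4 : ℝ) + 1) / 2 = (1 / 2 + 1) + 1 by norm_num, Real.Gamma_add_one (by norm_num),
      Real.Gamma_add_one (by norm_num), Real.Gamma_one_half_eq]
    ring
  have h3 : ((1 : ℝ) / 2) ^ (-(4 + 1) / 2 : ℝ) = 4 * √2 := by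
    rw [show (-(4 + 1) / 2 : ℝ) = -(2 + 1 / 2) by norm_num, Real.rpow_neg (by norm_num),
      Real.rpow_add (by norm_num), ← Real.sqrt_eq_rpow]
    norm_num
    ring
  rw [h2, h3, Real.sqrt_mul (by norm_num)]
  have := Real.pi_pos
  field_simp

end OneDim

section Multivariate

variable {ι : Type*} [Fintype ι]

lemma integral_exp_sum_sq {l : ℝ} (hl : l < 1 / 2) :
    ∫ x, Real.exp (l * ∑ i, x i ^ 2) ∂(stdGauss ι) = (√(1 - 2 * l))⁻¹ ^ Fintype.card ι := by
  simp_rw [Finset.mul_sum, Real.exp_sum]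
  rw [integral_fintype_prod_eq_pow (fun y : ℝ => Real.exp (l * y ^ 2)), integral_exp_sq_std hl]

lemma integrable_exp_sum_sq {l : ℝ} (hl : l < 1 / 2) :
    Integrable (fun x => Real.exp (l * ∑ i, x i ^ 2)) (stdGauss ι) := by
  refine Integrable.of_integral_ne_zero ?_
  rw [integral_exp_sum_sq hl]
  have : 0 < 1 - 2 * l := by linarith
  positivity

lemma integral_comp_eval (i : ι) {f : ℝ → ℝ} (hf : Measurable f) :
    ∫ x, f (x i) ∂(stdGauss ι) = ∫ y, f y ∂(gaussianReal 0 1) :=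
  (measurePreserving_eval (fun _ : ι => gaussianReal 0 1) i).hasLaw.integral_comp
    hf.aestronglyMeasurable

lemma memLp_eval (i : ι) (k : ℕ) : MemLp (fun x : ι → ℝ => x i ^ k) 2 (stdGauss ι) := by
  rw [memLp_two_iff_integrable_sq (Measurable.aestronglyMeasurable (by fun_prop))]
  have := (measurePreserving_eval (fun _ : ι => gaussianReal 0 1) i).integrable_comp_of_integrable
    (integrable_pow_std (k * 2))
  simpa [Function.comp_def, pow_mul] using this

lemma memLp_sum_sq : MemLp (fun x : ι → ℝ => ∑ i, x i ^ 2) 2 (stdGauss ι) :=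
  memLp_finsetSum _ fun i _ => memLp_eval i 2

lemma memLp_dotProduct (a : ι → ℝ) : MemLp (fun x : ι → ℝ => ∑ i, a i * x i) 2 (stdGauss ι) :=
  memLp_finsetSum _ fun i _ => by simpa using (memLp_eval i 1).const_mul (a i)

lemma iIndepFun_eval {f : ι → ℝ → ℝ} (hf : ∀ i, Measurable (f i)) :
    iIndepFun (fun i (x : ι → ℝ) => f i (x i)) (stdGauss ι) :=
  iIndepFun_pi fun i => (hf i).aemeasurable

lemma integral_sum_sq : ∫ x, ∑ i, x i ^ 2 ∂(stdGauss ι) = Fintype.card ι := by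
  rw [integral_finsetSum _ fun i _ => (memLp_eval i 2).integrable (by norm_num)]
  simp [integral_comp_eval _ (f := fun y : ℝ => y ^ 2) (by fun_prop), integral_sq_std]

lemma integral_sub_sq_sum_sq :
    ∫ x, (∑ i, x i ^ 2 - Fintype.card ι) ^ 2 ∂(stdGauss ι) = 2 * Fintype.card ι := by
  have h := IndepFun.variance_sum (μ := stdGauss ι) (X := fun i (x : ι → ℝ) => x i ^ 2)
    (s := Finset.univ) (fun i _ => memLp_eval i 2) (fun i _ j _ hij =>
      (iIndepFun_eval (f := fun _ y => y ^ 2) (fun _ => by fun_prop)).indepFun hij)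
  rw [variance_eq_integral (Measurable.aemeasurable (by fun_prop))] at h
  simp only [Finset.sum_apply, integral_sum_sq] at h
  rw [h, Finset.sum_congr rfl (g := fun _ => (2 : ℝ))]
  · simp [mul_comm]
  · intro i _
    rw [variance_eq_sub (memLp_eval i 2)]
    simp only [Pi.pow_apply, ← pow_mul]
    rw [integral_comp_eval _ (f := fun y : ℝ => y ^ 2) (by fun_prop),
      integral_comp_eval _ (f := fun y : ℝ => y ^ (2 * 2)) (by fun_prop), integral_sq_std,
      integral_pow_four_std]
    norm_num

lemma integrable_sum_sq_sq : Integrable (fun x => (∑ i, x i ^ 2) ^ 2) (stdGauss ι) :=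
  memLp_sum_sq.integrable_sq

lemma integral_sum_sq_sq :
    ∫ x, (∑ i, x i ^ 2) ^ 2 ∂(stdGauss ι) = (Fintype.card ι : ℝ) ^ 2 + 2 * Fintype.card ι := by
  have h := variance_eq_sub (memLp_sum_sq (ι := ι))
  rw [variance_eq_integral (Measurable.aemeasurable (by fun_prop)), integral_sum_sq,
    integral_sub_sq_sum_sq] at h
  simp only [Pi.pow_apply] at h
  linarith

instance isNegInvariant_gaussianReal_zero_one : (gaussianReal 0 1).IsNegInvariant := ⟨by
  rw [Measure.neg_def]
  exact gaussianReal_map_neg.trans (by simp)⟩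

/-- Odd functions have mean zero. -/
lemma integral_eq_zero_of_odd {f : (ι → ℝ) → ℝ} (hf : ∀ x, f (-x) = -f x) :
    ∫ x, f x ∂(stdGauss ι) = 0 := by
  have h := integral_neg_eq_self f (stdGauss ι)
  simp_rw [hf, integral_neg] at h
  linarith

lemma integral_dotProduct (a : ι → ℝ) : ∫ x, ∑ i, a i * x i ∂(stdGauss ι) = 0 :=
  integral_eq_zero_of_odd fun x => by simp

lemma integral_dotProduct_sq (a : ι → ℝ) :
    ∫ x, (∑ i, a i * x i) ^ 2 ∂(stdGauss ι) = ∑ i, a i ^ 2 := by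
  have h := IndepFun.variance_sum (μ := stdGauss ι) (X := fun i (x : ι → ℝ) => a i * x i)
    (s := Finset.univ) (fun i _ => by simpa using (memLp_eval i 1).const_mul (a i))
    (fun i _ j _ hij =>
      (iIndepFun_eval (f := fun i y => a i * y) (fun _ => by fun_prop)).indepFun hij)
  rw [variance_eq_integral (Measurable.aemeasurable (by fun_prop))] at h
  simp only [Finset.sum_apply, integral_dotProduct, sub_zero] at h
  rw [h]
  refine Finset.sum_congr rfl fun i _ => ?_
  have h0 : ∫ x : ι → ℝ, x i ∂(stdGauss ι) = 0 := integral_eq_zero_of_odd fun x => by simp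
  rw [variance_const_mul, variance_eq_sub (by simpa using memLp_eval i 1)]
  simp only [Pi.pow_apply, h0]
  rw [integral_comp_eval _ (f := fun y : ℝ => y ^ 2) (by fun_prop), integral_sq_std]
  ring

/-- A matrix with orthonormal rows maps the standard Gaussian measure to the standard Gaussian
measure. -/
lemma map_mulVec_stdGauss {κ : Type*} [Fintype κ] [DecidableEq ι] (A : Matrix ι κ ℝ)
    (hA : A * A.transpose = 1) :
    (stdGauss κ).map (fun x => A.mulVec x) = stdGauss ι := by
  have hm : Measurable fun x : κ → ℝ => A.mulVec x :=
    Continuous.measurable (by fun_prop)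
  have key : ((stdGauss κ).map (fun x => A.mulVec x)).map (WithLp.toLp 2) =
      (stdGauss ι).map (WithLp.toLp 2) := by
    rw [map_pi_eq_stdGaussian]
    apply Measure.ext_of_charFun (E := EuclideanSpace ℝ ι)
    ext t
    have h1 : charFun (((stdGauss κ).map (fun x => A.mulVec x)).map (WithLp.toLp 2)) t =
        charFun ((stdGauss κ).map (WithLp.toLp 2)) (WithLp.toLp 2 (A.transpose.mulVec t.ofLp)) := by
      rw [charFun_apply, charFun_apply, integral_map (by fun_prop) (by fun_prop),
        integral_map (by fun_prop) (by fun_prop), integral_map (by fun_prop) (by fun_prop)]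
      congr with x
      congr 3
      simp only [EuclideanSpace.inner_eq_star_dotProduct, star_trivial]
      rw [Matrix.mulVec_transpose, ← Matrix.dotProduct_mulVec, dotProduct_comm]
    rw [h1, map_pi_eq_stdGaussian, charFun_stdGaussian, charFun_stdGaussian]
    have h2 : ‖WithLp.toLp 2 (A.transpose.mulVec t.ofLp)‖ ^ 2 = ‖t‖ ^ 2 := by
      rw [EuclideanSpace.real_norm_sq_eq, EuclideanSpace.real_norm_sq_eq]
      have h3 : A.transpose.mulVec t.ofLp ⬝ᵥ A.transpose.mulVec t.ofLp = t.ofLp ⬝ᵥ t.ofLp := by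
        rw [Matrix.mulVec_transpose, ← Matrix.dotProduct_mulVec, ← Matrix.mulVec_transpose,
          Matrix.mulVec_mulVec, hA, Matrix.one_mulVec]
      simpa [dotProduct, ← sq] using h3
    norm_cast
    rw [h2]
  have h2 := congrArg (Measure.map (WithLp.ofLp (p := 2))) key
  rw [Measure.map_map (by fun_prop) (by fun_prop), Measure.map_map (by fun_prop) (by fun_prop),
    Measure.map_map (by fun_prop) (by fun_prop)]
    at h2
  simpa [Function.comp_def] using h2

end Multivariate

/-! ### Change of measure and the averaged exponential moment -/

section Density

variable {ι : Type*} [Fintype ι]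

/-- The square of the Euclidean norm of a vector. -/
def sqNorm (x : ι → ℝ) : ℝ := ∑ i, x i ^ 2

lemma sqNorm_nonneg (x : ι → ℝ) : 0 ≤ sqNorm x := Finset.sum_nonneg fun _ _ => sq_nonneg _

lemma sqNorm_smul (c : ℝ) (x : ι → ℝ) : sqNorm (c • x) = c ^ 2 * sqNorm x := by
  simp [sqNorm, mul_pow, Finset.mul_sum]

lemma sqNorm_eq_zero {x : ι → ℝ} : sqNorm x = 0 ↔ x = 0 := by
  rw [sqNorm, Finset.sum_eq_zero_iff_of_nonneg fun _ _ => sq_nonneg _]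
  simp [funext_iff]

@[fun_prop]
lemma continuous_sqNorm : Continuous (sqNorm : (ι → ℝ) → ℝ) := by
  unfold sqNorm
  fun_prop

lemma sqNorm_add (x y : ι → ℝ) :
    sqNorm (x + y) = sqNorm x + 2 * ∑ i, x i * y i + sqNorm y := by
  simp only [sqNorm, Pi.add_apply, Finset.mul_sum, ← Finset.sum_add_distrib]
  exact Finset.sum_congr rfl fun i _ => by ring

lemma prod_gaussianPDFReal (x : ι → ℝ) : ∏ i, gaussianPDFReal 0 1 (x i) =
    (√(2 * Real.pi))⁻¹ ^ Fintype.card ι * Real.exp (-(1 / 2) * sqNorm x) := by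
  simp_rw [gaussianPDFReal_std]
  rw [Finset.prod_mul_distrib, ← Real.exp_sum, ← Finset.mul_sum, Finset.prod_const]
  rfl

lemma stdGauss_eq_withDensity : stdGauss ι = (volume : Measure (ι → ℝ)).withDensity
    fun x => ENNReal.ofReal (∏ i, gaussianPDFReal 0 1 (x i)) := by
  refine Measure.pi_eq fun s hs => ?_
  have hint : Integrable (fun x : ι → ℝ => ∏ i, gaussianPDFReal 0 1 (x i))
      (volume.restrict (Set.univ.pi s)) := by
    rw [volume_pi, Measure.restrict_pi_pi]
    exact Integrable.fintype_prod fun i => (integrable_gaussianPDFReal 0 1).integrableOn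
  have hnn : ∀ x : ι → ℝ, 0 ≤ ∏ i, gaussianPDFReal 0 1 (x i) :=
    fun x => Finset.prod_nonneg fun i _ => gaussianPDFReal_nonneg _ _ _
  rw [withDensity_apply _ (MeasurableSet.univ_pi hs),
    ← ofReal_integral_eq_lintegral_ofReal hint (Filter.Eventually.of_forall hnn), volume_pi,
    Measure.restrict_pi_pi, integral_fintype_prod_eq_prod,
    ENNReal.ofReal_prod_of_nonneg fun i _ => integral_nonneg fun _ => gaussianPDFReal_nonneg _ _ _]
  exact Finset.prod_congr rfl fun i _ => (gaussianReal_apply_eq_integral 0 one_ne_zero _).symm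

lemma integral_stdGauss (f : (ι → ℝ) → ℝ) : ∫ x, f x ∂(stdGauss ι) =
    (√(2 * Real.pi))⁻¹ ^ Fintype.card ι * ∫ x, f x * Real.exp (-(1 / 2) * sqNorm x) := by
  rw [stdGauss_eq_withDensity, integral_withDensity_eq_integral_toReal_smul
    (by fun_prop) (by simp), ← integral_const_mul]
  congr with x
  rw [ENNReal.toReal_ofReal (Finset.prod_nonneg fun i _ => gaussianPDFReal_nonneg _ _ _),
    prod_gaussianPDFReal, smul_eq_mul]
  ring

lemma integrable_stdGauss_iff (f : (ι → ℝ) → ℝ) : Integrable f (stdGauss ι) ↔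
    Integrable fun x => f x * Real.exp (-(1 / 2) * sqNorm x) := by
  have h0 : (√(2 * Real.pi))⁻¹ ^ Fintype.card ι ≠ 0 := by
    have := Real.pi_pos
    positivity
  rw [stdGauss_eq_withDensity, integrable_withDensity_iff_integrable_smul'
    (by fun_prop) (by simp), ← integrable_const_mul_iff h0.isUnit
    (fun x => f x * Real.exp (-(1 / 2) * sqNorm x))]
  refine integrable_congr (Filter.Eventually.of_forall fun x => ?_)
  simp only
  rw [ENNReal.toReal_ofReal (Finset.prod_nonneg fun i _ => gaussianPDFReal_nonneg _ _ _),
    prod_gaussianPDFReal, smul_eq_mul]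
  ring

/-- Change of measure from the standard Gaussian law to the law of `(h + x) / 2`. -/
lemma integral_shift (f : (ι → ℝ) → ℝ) (h : ι → ℝ) : ∫ x, f x ∂(stdGauss ι) =
    (2⁻¹ : ℝ) ^ Fintype.card ι * ∫ x, f ((2⁻¹ : ℝ) • (h + x)) *
      Real.exp (sqNorm x / 2 - sqNorm (h + x) / 8) ∂(stdGauss ι) := by
  rw [integral_stdGauss, integral_stdGauss, mul_left_comm]
  congr 1
  have h1 : ∀ x : ι → ℝ, f ((2⁻¹ : ℝ) • (h + x)) * Real.exp (sqNorm x / 2 - sqNorm (h + x) / 8) *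
      Real.exp (-(1 / 2) * sqNorm x) =
      (fun z => f z * Real.exp (-(1 / 2) * sqNorm z)) ((2⁻¹ : ℝ) • (h + x)) := by
    intro x
    simp only
    rw [mul_assoc, ← Real.exp_add, sqNorm_smul]
    ring_nf
  simp_rw [h1]
  rw [integral_add_left_eq_self
    (fun y => (fun z => f z * Real.exp (-(1 / 2) * sqNorm z)) ((2⁻¹ : ℝ) • y)) h,
    Measure.integral_comp_smul volume (fun z => f z * Real.exp (-(1 / 2) * sqNorm z)),
    Module.finrank_fintype_fun_eq_card, smul_eq_mul, ← mul_assoc]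
  simp

lemma integrable_shift {f : (ι → ℝ) → ℝ} (hf : Integrable f (stdGauss ι)) (h : ι → ℝ) :
    Integrable (fun x => f ((2⁻¹ : ℝ) • (h + x)) *
      Real.exp (sqNorm x / 2 - sqNorm (h + x) / 8)) (stdGauss ι) := by
  rw [integrable_stdGauss_iff] at hf ⊢
  refine ((hf.comp_smul (R := (2⁻¹ : ℝ)) (by norm_num)).comp_add_left h).congr
    (Filter.Eventually.of_forall fun x => ?_)
  simp only
  rw [mul_assoc, ← Real.exp_add, sqNorm_smul]
  ring_nf

end Density

section Gibbs

/-- The matrix with the entries `y (i, t)`. -/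
def toMat {ι : Type*} {T : ℕ} (y : ι × Fin T → ℝ) : Matrix ι (Fin T) ℝ :=
  Matrix.of fun i t => y (i, t)

lemma continuous_toMat {ι : Type*} {T : ℕ} :
    Continuous (toMat : (ι × Fin T → ℝ) → Matrix ι (Fin T) ℝ) := by
  unfold toMat
  fun_prop

variable {ι : Type*} [Fintype ι] {T : ℕ}

/-- The square of the Frobenius norm. -/
def frobSq (F : Matrix ι (Fin T) ℝ) : ℝ := ∑ i, sqNorm (F i)

lemma frobSq_nonneg (F : Matrix ι (Fin T) ℝ) : 0 ≤ frobSq F :=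
  Finset.sum_nonneg fun _ _ => sqNorm_nonneg _

lemma sqNorm_mulVec_le (F : Matrix ι (Fin T) ℝ) (x : Fin T → ℝ) :
    sqNorm (F.mulVec x) ≤ frobSq F * sqNorm x := by
  rw [frobSq, Finset.sum_mul]
  exact Finset.sum_le_sum fun i _ => Finset.sum_mul_sq_le_sq_mul_sq Finset.univ (F i) x

/-- The integrand of `partition`. -/
noncomputable def weight (l : ℝ) (F : Matrix ι (Fin T) ℝ) (x : Fin T → ℝ) : ℝ :=
  sqNorm x * Real.exp (l * (sqNorm (F.mulVec x) / sqNorm x))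

/-- The average of `exp (l ‖F θ‖²)` over the directions `θ = x / ‖x‖` of a standard Gaussian
vector `x`, weighted by `‖x‖² / T`. -/
noncomputable def partition (l : ℝ) (F : Matrix ι (Fin T) ℝ) : ℝ :=
  (T : ℝ)⁻¹ * ∫ x, weight l F x ∂(stdGauss (Fin T))

lemma weight_nonneg (l : ℝ) (F : Matrix ι (Fin T) ℝ) (x : Fin T → ℝ) : 0 ≤ weight l F x :=
  mul_nonneg (sqNorm_nonneg _) (Real.exp_nonneg _)

lemma weight_le (l : ℝ) (F : Matrix ι (Fin T) ℝ) (x : Fin T → ℝ) :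
    weight l F x ≤ Real.exp (|l| * frobSq F) * sqNorm x := by
  rw [weight, mul_comm]
  have h1 : sqNorm (F.mulVec x) / sqNorm x ≤ frobSq F :=
    div_le_of_le_mul₀ (sqNorm_nonneg _) (frobSq_nonneg F) (sqNorm_mulVec_le F x)
  have h2 : 0 ≤ sqNorm (F.mulVec x) / sqNorm x :=
    div_nonneg (sqNorm_nonneg _) (sqNorm_nonneg _)
  have h3 := le_abs_self l
  have h4 := sqNorm_nonneg x
  gcongr

lemma weight_smul {c : ℝ} (hc : c ≠ 0) (l : ℝ) (F : Matrix ι (Fin T) ℝ) (x : Fin T → ℝ) :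
    weight l F (c • x) = c ^ 2 * weight l F x := by
  rw [weight, weight, Matrix.mulVec_smul, sqNorm_smul, sqNorm_smul,
    mul_div_mul_left _ _ (pow_ne_zero 2 hc), mul_assoc]

lemma measurable_weight (l : ℝ) :
    Measurable fun p : (ι × Fin T → ℝ) × (Fin T → ℝ) => weight l (toMat p.1) p.2 := by
  unfold weight
  have h1 : Continuous fun p : (ι × Fin T → ℝ) × (Fin T → ℝ) => sqNorm ((toMat p.1).mulVec p.2) :=
    continuous_sqNorm.comp
      (Continuous.matrix_mulVec (continuous_toMat.comp continuous_fst) continuous_snd)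
  have h2 : Continuous fun p : (ι × Fin T → ℝ) × (Fin T → ℝ) => sqNorm p.2 := by fun_prop
  exact h2.measurable.mul
    (Real.measurable_exp.comp ((h1.measurable.div h2.measurable).const_mul l))

lemma integrable_sqNorm : Integrable (sqNorm : (ι → ℝ) → ℝ) (stdGauss ι) :=
  memLp_sum_sq.integrable (by norm_num)

lemma integral_sqNorm : ∫ x, sqNorm x ∂(stdGauss ι) = Fintype.card ι := integral_sum_sq

lemma integrable_weight (l : ℝ) (F : Matrix ι (Fin T) ℝ) :
    Integrable (weight l F) (stdGauss (Fin T)) := by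
  refine (integrable_sqNorm.const_mul (Real.exp (|l| * frobSq F))).mono' ?_ ?_
  · exact ((measurable_weight l).comp (measurable_const.prodMk measurable_id : Measurable
      fun x : Fin T → ℝ => ((fun p : ι × Fin T => F p.1 p.2), x))).aestronglyMeasurable
  · refine Filter.Eventually.of_forall fun x => ?_
    rw [Real.norm_of_nonneg (weight_nonneg _ _ _)]
    exact weight_le l F x

end Gibbs

/-! ### The Gibbs variational bound and the mean over a Gaussian matrix -/

section HasMean

variable {Ω : Type*} [MeasurableSpace Ω] {P : Measure Ω} {f g : Ω → ℝ} {a b : ℝ}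

/-- The function `f` is integrable with integral `a`. -/
def HasMean (P : Measure Ω) (f : Ω → ℝ) (a : ℝ) : Prop := Integrable f P ∧ ∫ x, f x ∂P = a

lemma HasMean.add (hf : HasMean P f a) (hg : HasMean P g b) :
    HasMean P (fun x => f x + g x) (a + b) :=
  ⟨hf.1.add hg.1, by rw [integral_add hf.1 hg.1, hf.2, hg.2]⟩

lemma HasMean.sub (hf : HasMean P f a) (hg : HasMean P g b) :
    HasMean P (fun x => f x - g x) (a - b) :=
  ⟨hf.1.sub hg.1, by rw [integral_sub hf.1 hg.1, hf.2, hg.2]⟩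

lemma HasMean.const_mul (hf : HasMean P f a) (c : ℝ) : HasMean P (fun x => c * f x) (c * a) :=
  ⟨hf.1.const_mul c, by rw [integral_const_mul, hf.2]⟩

lemma hasMean_const [IsProbabilityMeasure P] (c : ℝ) : HasMean P (fun _ => c) c :=
  ⟨integrable_const c, by simp⟩

lemma hasMean_finsetSum {ι : Type*} [Fintype ι] {f : ι → Ω → ℝ} {a : ι → ℝ}
    (hf : ∀ i, HasMean P (f i) (a i)) : HasMean P (fun x => ∑ i, f i x) (∑ i, a i) :=
  ⟨integrable_finsetSum _ fun i _ => (hf i).1, by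
    rw [integral_finsetSum _ fun i _ => (hf i).1]
    exact Finset.sum_congr rfl fun i _ => (hf i).2⟩

lemma HasMean.congr_val (hf : HasMean P f a) (h : a = b) : HasMean P f b := h ▸ hf

end HasMean

section GibbsBound

variable {ι : Type*} [Fintype ι] {T : ℕ}

lemma hasMean_sqNorm : HasMean (stdGauss ι) sqNorm (Fintype.card ι) :=
  ⟨integrable_sqNorm, integral_sqNorm⟩

lemma hasMean_sqNorm_sq : HasMean (stdGauss ι) (fun x => sqNorm x ^ 2)
    ((Fintype.card ι : ℝ) ^ 2 + 2 * Fintype.card ι) :=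
  ⟨integrable_sum_sq_sq, integral_sum_sq_sq⟩

lemma hasMean_dotProduct (a : ι → ℝ) : HasMean (stdGauss ι) (fun x => ∑ i, a i * x i) 0 :=
  ⟨(memLp_dotProduct a).integrable (by norm_num), integral_dotProduct a⟩

lemma hasMean_dotProduct_sq (a : ι → ℝ) :
    HasMean (stdGauss ι) (fun x => (∑ i, a i * x i) ^ 2) (sqNorm a) :=
  ⟨(memLp_dotProduct a).integrable_sq, integral_dotProduct_sq a⟩

lemma hasMean_dotProduct_mul_sqNorm (a : ι → ℝ) :
    HasMean (stdGauss ι) (fun x => (∑ i, a i * x i) * sqNorm x) 0 :=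
  ⟨(memLp_dotProduct a).integrable_mul memLp_sum_sq,
    integral_eq_zero_of_odd fun x => by simp [sqNorm]⟩

lemma hasMean_sqNorm_mulVec_add (F : Matrix ι (Fin T) ℝ) (h : Fin T → ℝ) :
    HasMean (stdGauss (Fin T)) (fun x => sqNorm (F.mulVec (h + x)))
      (sqNorm (F.mulVec h) + frobSq F) := by
  have h1 : ∀ (i : ι) (x : Fin T → ℝ), (F.mulVec (h + x) i) ^ 2 =
      (F.mulVec h i) ^ 2 + 2 * F.mulVec h i * (∑ t, F i t * x t) + (∑ t, F i t * x t) ^ 2 := by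
    intro i x
    rw [Matrix.mulVec_add, Pi.add_apply]
    have : F.mulVec x i = ∑ t, F i t * x t := rfl
    rw [this]
    ring
  have h2 := hasMean_finsetSum fun i => ((hasMean_const (P := stdGauss (Fin T))
    ((F.mulVec h i) ^ 2)).add ((hasMean_dotProduct (F i)).const_mul (2 * F.mulVec h i))).add
      (hasMean_dotProduct_sq (F i))
  simp_rw [← h1] at h2
  refine h2.congr_val ?_
  rw [sqNorm, frobSq, ← Finset.sum_add_distrib]
  exact Finset.sum_congr rfl fun i _ => by ring

lemma hasMean_sqNorm_add (h : ι → ℝ) :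
    HasMean (stdGauss ι) (fun x => sqNorm (h + x)) (sqNorm h + Fintype.card ι) := by
  simp_rw [sqNorm_add]
  exact (((hasMean_const _).add ((hasMean_dotProduct h).const_mul 2)).add
    hasMean_sqNorm).congr_val (by ring)

lemma hasMean_sqNorm_add_mul (h : ι → ℝ) :
    HasMean (stdGauss ι) (fun x => sqNorm (h + x) * (sqNorm x / 2 - sqNorm (h + x) / 8))
      (3 / 8 * ((Fintype.card ι : ℝ) ^ 2 + 2 * Fintype.card ι)
      + 1 / 4 * sqNorm h * Fintype.card ι - 1 / 2 * sqNorm h - 1 / 8 * sqNorm h ^ 2) := by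
  have h1 : ∀ x : ι → ℝ, sqNorm (h + x) * (sqNorm x / 2 - sqNorm (h + x) / 8) =
      3 / 8 * sqNorm x ^ 2 + 1 / 4 * sqNorm h * sqNorm x - 1 / 2 * (∑ i, h i * x i) ^ 2
      - 1 / 8 * sqNorm h ^ 2 + 1 / 2 * ((∑ i, h i * x i) * sqNorm x)
      - 1 / 2 * sqNorm h * (∑ i, h i * x i) := by
    intro x
    rw [sqNorm_add]
    ring
  simp_rw [h1]
  exact ((((((hasMean_sqNorm_sq.const_mul (3 / 8)).add
    (hasMean_sqNorm.const_mul (1 / 4 * sqNorm h))).sub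
    ((hasMean_dotProduct_sq h).const_mul (1 / 2))).sub (hasMean_const (1 / 8 * sqNorm h ^ 2))).add
    ((hasMean_dotProduct_mul_sqNorm h).const_mul (1 / 2))).sub
    ((hasMean_dotProduct h).const_mul (1 / 2 * sqNorm h))).congr_val (by ring)

/-- An upper bound for the relative entropy, with respect to the uniform distribution of
directions, of the directions concentrated around a given one that `exp_le_partition` uses. -/
noncomputable def entropyBound (T : ℕ) : ℝ := T * Real.log 2 + 3 / 16

/-- The Gibbs variational principle for `partition`. The comparison law is that of `(h + x) / 2`
with `h = √(3 T) u` and `x` standard Gaussian, weighted by its squared norm; under it the mean of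
`‖F θ‖²` is `3 / 4 ‖F u‖² + 1 / 4 ‖F‖² / T`. -/
theorem exp_le_partition (hT : 0 < T) (l : ℝ) (F : Matrix ι (Fin T) ℝ) {u : Fin T → ℝ}
    (hu : sqNorm u = 1) :
    Real.exp (l * (3 / 4 * sqNorm (F.mulVec u) + 1 / 4 * (frobSq F / T)) - entropyBound T) ≤
      partition l F := by
  have hT' : (0 : ℝ) < T := by exact_mod_cast hT
  set h : Fin T → ℝ := √(3 * T) • u with hh
  have hhn : sqNorm h = 3 * T := by
    rw [hh, sqNorm_smul, hu, Real.sq_sqrt (by positivity), mul_one]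
  have hFh : sqNorm (F.mulVec h) = 3 * T * sqNorm (F.mulVec u) := by
    rw [hh, Matrix.mulVec_smul, sqNorm_smul, Real.sq_sqrt (by positivity)]
  set t : ℝ := l * (3 / 4 * sqNorm (F.mulVec u) + 1 / 4 * (frobSq F / T)) - 3 / 16 with ht
  have hmean := ((((hasMean_sqNorm_mulVec_add F h).const_mul l).add
    (hasMean_sqNorm_add_mul h)).add ((hasMean_sqNorm_add h).const_mul (1 - t))).const_mul
    (1 / 4 * Real.exp t)
  -- Tangent of the exponential at `t`; the factor `‖h + x‖²` turns the quotient in `weight` into a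
  -- quadratic polynomial.
  have hpt : ∀ x : Fin T → ℝ, 1 / 4 * Real.exp t * (l * sqNorm (F.mulVec (h + x)) +
      sqNorm (h + x) * (sqNorm x / 2 - sqNorm (h + x) / 8) + (1 - t) * sqNorm (h + x)) ≤
      weight l F ((2⁻¹ : ℝ) • (h + x)) * Real.exp (sqNorm x / 2 - sqNorm (h + x) / 8) := by
    intro x
    rw [weight_smul (by norm_num), weight]
    set N := sqNorm (h + x) with hN
    set w := sqNorm x / 2 - N / 8
    have hN0 : 0 ≤ N := sqNorm_nonneg _
    have hr : sqNorm (F.mulVec (h + x)) = N * (sqNorm (F.mulVec (h + x)) / N) := by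
      rcases eq_or_ne N 0 with h0 | h0
      · have := sqNorm_eq_zero.1 h0
        rw [h0, this]
        simp [sqNorm]
      · field_simp
    set ρ := sqNorm (F.mulVec (h + x)) / N
    have htan : Real.exp t * (l * ρ + w + 1 - t) ≤ Real.exp (l * ρ) * Real.exp w := by
      have h1 := Real.add_one_le_exp (l * ρ + w - t)
      have h2 : Real.exp (l * ρ) * Real.exp w = Real.exp t * Real.exp (l * ρ + w - t) := by
        rw [← Real.exp_add, ← Real.exp_add]
        ring_nf
      rw [h2]
      gcongr
      linarith
    have h3 := mul_le_mul_of_nonneg_left htan hN0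
    rw [hr]
    linarith
  have hint := integral_mono hmean.1 (integrable_shift (integrable_weight l F) h) hpt
  rw [hmean.2, hhn, hFh, Fintype.card_fin] at hint
  rw [partition, integral_shift _ h, Fintype.card_fin]
  have hexp : Real.exp (l * (3 / 4 * sqNorm (F.mulVec u) + 1 / 4 * (frobSq F / T)) - entropyBound T)
      = (2⁻¹ : ℝ) ^ T * Real.exp t := by
    have : (2⁻¹ : ℝ) ^ T = Real.exp (-(T * Real.log 2)) := by
      rw [Real.exp_neg, Real.exp_nat_mul, Real.exp_log (by norm_num), inv_pow]
    rw [this, ← Real.exp_add, ht, entropyBound]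
    ring_nf
  rw [hexp]
  have hval : 1 / 4 * Real.exp t * (l * (3 * T * sqNorm (F.mulVec u) + frobSq F) +
      (3 / 8 * ((T : ℝ) ^ 2 + 2 * T) + 1 / 4 * (3 * T) * T - 1 / 2 * (3 * T)
        - 1 / 8 * (3 * T) ^ 2) +
      (1 - t) * (3 * T + T)) = T * Real.exp t := by
    rw [ht]
    field_simp
    ring
  rw [hval] at hint
  rw [← mul_assoc, mul_comm (T : ℝ)⁻¹, mul_assoc]
  have : Real.exp t = (T : ℝ)⁻¹ * (T * Real.exp t) := by field_simp
  rw [this]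
  gcongr

end GibbsBound

section Average

variable {ι : Type*} [Fintype ι] {T : ℕ}

/-- For a unit vector `u`, the image `F u` of a standard Gaussian matrix is a standard Gaussian
vector. -/
lemma map_toMat_mulVec {u : Fin T → ℝ} (hu : sqNorm u = 1) :
    (stdGauss (ι × Fin T)).map (fun y => (toMat y).mulVec u) = stdGauss ι := by
  classical
  let A : Matrix ι (ι × Fin T) ℝ := Matrix.of fun i p => if p.1 = i then u p.2 else 0
  have hA : A * A.transpose = 1 := by
    ext i j
    rw [Matrix.mul_apply, Fintype.sum_prod_type]
    simp only [A, Matrix.of_apply, Matrix.transpose_apply, Matrix.one_apply]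
    by_cases hij : i = j
    · subst hij
      rw [Finset.sum_eq_single i]
      · simpa [sqNorm, ← sq] using hu
      · intro b _ hb
        simp [hb]
      · simp
    · rw [if_neg hij]
      refine Finset.sum_eq_zero fun k _ => Finset.sum_eq_zero fun t _ => ?_
      by_cases hk : k = i
      · subst hk
        simp [hij]
      · simp [hk]
  rw [← map_mulVec_stdGauss A hA]
  congr 1
  ext y i
  rw [Matrix.mulVec, Matrix.mulVec, dotProduct, dotProduct, Fintype.sum_prod_type,
    Finset.sum_eq_single i]
  · exact Finset.sum_congr rfl fun t _ => by simp [A, toMat, mul_comm]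
  · intro b _ hb
    simp [A, hb]
  · simp

lemma integral_weight {l : ℝ} (hl : l < 1 / 2) (x : Fin T → ℝ) :
    Integrable (fun y => weight l (toMat y) x) (stdGauss (ι × Fin T)) ∧
    ∫ y, weight l (toMat y) x ∂(stdGauss (ι × Fin T)) =
      sqNorm x * (√(1 - 2 * l))⁻¹ ^ Fintype.card ι := by
  rcases eq_or_ne x 0 with rfl | hx
  · simp [weight, sqNorm]
  have hN : 0 < sqNorm x :=
    lt_of_le_of_ne (sqNorm_nonneg x) fun h => hx (sqNorm_eq_zero.1 h.symm)
  set u : Fin T → ℝ := (√(sqNorm x))⁻¹ • x with hu'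
  have hu : sqNorm u = 1 := by
    rw [hu', sqNorm_smul, inv_pow, Real.sq_sqrt hN.le, inv_mul_cancel₀ hN.ne']
  have h1 : ∀ y : ι × Fin T → ℝ, weight l (toMat y) x =
      sqNorm x * Real.exp (l * sqNorm ((toMat y).mulVec u)) := by
    intro y
    rw [weight, hu', Matrix.mulVec_smul, sqNorm_smul, inv_pow, Real.sq_sqrt hN.le, div_eq_inv_mul]
  have hmp : MeasurePreserving (fun y : ι × Fin T → ℝ => (toMat y).mulVec u)
      (stdGauss (ι × Fin T)) (stdGauss ι) :=
    ⟨(continuous_toMat.matrix_mulVec continuous_const).measurable, map_toMat_mulVec hu⟩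
  simp_rw [h1]
  have hi : Integrable (fun z => Real.exp (l * sqNorm z)) (stdGauss ι) := integrable_exp_sum_sq hl
  refine ⟨(hmp.integrable_comp_of_integrable hi).const_mul _, ?_⟩
  rw [integral_const_mul, ← integral_exp_sum_sq (ι := ι) hl]
  congr 1
  exact hmp.hasLaw.integral_comp (f := fun z => Real.exp (l * sqNorm z)) hi.aestronglyMeasurable

lemma integrable_weight_prod {l : ℝ} (hl : l < 1 / 2) :
    Integrable (fun p : (ι × Fin T → ℝ) × (Fin T → ℝ) => weight l (toMat p.1) p.2)
      ((stdGauss (ι × Fin T)).prod (stdGauss (Fin T))) := by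
  rw [integrable_prod_iff' (measurable_weight l).aestronglyMeasurable]
  refine ⟨Filter.Eventually.of_forall fun x => (integral_weight hl x).1, ?_⟩
  simp_rw [Real.norm_of_nonneg (weight_nonneg _ _ _), (integral_weight hl _).2]
  exact integrable_sqNorm.mul_const _

lemma integrable_partition {l : ℝ} (hl : l < 1 / 2) :
    Integrable (fun y => partition l (toMat y)) (stdGauss (ι × Fin T)) :=
  (integrable_weight_prod hl).integral_prod_left.const_mul _

/-- The mean of `partition` over a standard Gaussian matrix is a chi-square exponential moment. -/
lemma integral_partition (hT : 0 < T) {l : ℝ} (hl : l < 1 / 2) :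
    ∫ y, partition l (toMat y) ∂(stdGauss (ι × Fin T)) =
      (√(1 - 2 * l))⁻¹ ^ Fintype.card ι := by
  have hT' : (T : ℝ) ≠ 0 := by exact_mod_cast hT.ne'
  unfold partition
  rw [integral_const_mul, integral_integral_swap (integrable_weight_prod hl)]
  simp_rw [(integral_weight hl _).2]
  rw [integral_mul_const, integral_sqNorm, Fintype.card_fin, ← mul_assoc, inv_mul_cancel₀ hT',
    one_mul]

end Average

/-! ### Uniform bounds for the image of a unit vector under a Gaussian matrix -/

section Uniform

variable {ι : Type*} [Fintype ι] {T : ℕ}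

lemma frobSq_toMat (y : ι × Fin T → ℝ) : frobSq (toMat y) = sqNorm y := by
  rw [frobSq, sqNorm, Fintype.sum_prod_type]
  rfl

/-- `partition`, normalised to have mean one over a standard Gaussian matrix. -/
noncomputable def normPartition (l : ℝ) (y : ι × Fin T → ℝ) : ℝ :=
  √(1 - 2 * l) ^ Fintype.card ι * partition l (toMat y)

lemma hasMean_normPartition (hT : 0 < T) {l : ℝ} (hl : l < 1 / 2) :
    HasMean (stdGauss (ι × Fin T)) (normPartition l) 1 := by
  have h0 : 0 < 1 - 2 * l := by linarith
  have h : HasMean (stdGauss (ι × Fin T)) (fun y => partition l (toMat y)) _ :=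
    ⟨integrable_partition hl, integral_partition hT hl⟩
  refine (h.const_mul (√(1 - 2 * l) ^ Fintype.card ι)).congr_val ?_
  rw [← mul_pow, mul_inv_cancel₀ (by positivity), one_pow]

lemma exp_le_normPartition (hT : 0 < T) {l : ℝ} (hl : l < 1 / 2) (y : ι × Fin T → ℝ)
    {u : Fin T → ℝ} (hu : sqNorm u = 1) :
    Real.exp (l * (3 / 4 * sqNorm ((toMat y).mulVec u) + 1 / 4 * (sqNorm y / T)) - entropyBound T
      + Fintype.card ι / 2 * Real.log (1 - 2 * l)) ≤ normPartition l y := by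
  have h0 : 0 < 1 - 2 * l := by linarith
  have h1 : √(1 - 2 * l) ^ Fintype.card ι =
      Real.exp (Fintype.card ι / 2 * Real.log (1 - 2 * l)) := by
    rw [div_mul_eq_mul_div, mul_div_assoc, ← Real.log_sqrt h0.le, Real.exp_nat_mul,
      Real.exp_log (by positivity)]
  rw [normPartition, Real.exp_add, mul_comm, h1, ← frobSq_toMat]
  gcongr
  exact exp_le_partition hT l _ hu

lemma entropyBound_le (hT : 2 ≤ T) : entropyBound T ≤ 0.81 * T := by
  have h1 := Real.log_two_lt_d9
  have h2 : (2 : ℝ) ≤ T := by exact_mod_cast hT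
  unfold entropyBound
  nlinarith

lemma hasMean_sqNorm_div (hT : 0 < T) :
    HasMean (stdGauss (ι × Fin T)) (fun y => sqNorm y / T) (Fintype.card ι) := by
  have hT' : (T : ℝ) ≠ 0 := by exact_mod_cast hT.ne'
  simp_rw [div_eq_inv_mul]
  refine (hasMean_sqNorm.const_mul _).congr_val ?_
  rw [Fintype.card_prod, Fintype.card_fin]
  push_cast
  field_simp

lemma hasMean_sqNorm_div_sub_sq (hT : 0 < T) :
    HasMean (stdGauss (ι × Fin T)) (fun y => (sqNorm y / T - Fintype.card ι) ^ 2)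
      (2 * Fintype.card ι / T) := by
  have hT' : (T : ℝ) ≠ 0 := by exact_mod_cast hT.ne'
  have h := ((hasMean_sqNorm_sq (ι := ι × Fin T)).const_mul ((T : ℝ)⁻¹ ^ 2)).sub
    (((hasMean_sqNorm_div (ι := ι) hT).const_mul (2 * Fintype.card ι)).sub
    (hasMean_const ((Fintype.card ι : ℝ) ^ 2)))
  have e : (fun y : ι × Fin T → ℝ => (sqNorm y / T - Fintype.card ι) ^ 2) = fun y =>
      (T : ℝ)⁻¹ ^ 2 * sqNorm y ^ 2 - (2 * Fintype.card ι * (sqNorm y / T)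
        - (Fintype.card ι : ℝ) ^ 2) := by
    ext y
    field_simp
    ring
  rw [e]
  refine h.congr_val ?_
  rw [Fintype.card_prod, Fintype.card_fin]
  push_cast
  field_simp
  ring

/-- `log x ≤ (x - 1 / x) / 2` for `x ≥ 1`. -/
lemma log_le_half_sub_inv {x : ℝ} (hx : 1 ≤ x) : Real.log x ≤ (x - x⁻¹) / 2 := by
  rw [← Real.sinh_log (by linarith)]
  exact Real.self_le_sinh_iff.2 (Real.log_nonneg hx)

/-- An integrable upper bound for the square of the largest singular value of a standard Gaussian
matrix with at least four times as many rows as columns. -/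
theorem exists_hasMean_sqNorm_le (hT : 2 ≤ T) (hι : 4 * T ≤ Fintype.card ι) :
    ∃ (f : (ι × Fin T → ℝ) → ℝ) (c : ℝ), HasMean (stdGauss (ι × Fin T)) f c ∧
      c ≤ (√(Fintype.card ι : ℝ) + 4 / 3 * √(T : ℝ)) ^ 2 ∧
      ∀ (y : ι × Fin T → ℝ) (u : Fin T → ℝ), sqNorm u = 1 → sqNorm ((toMat y).mulVec u) ≤ f y := by
  have hT0 : 0 < T := by omega
  set d : ℝ := (Fintype.card ι : ℝ) with hd
  set K := entropyBound T with hK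
  have hKT := entropyBound_le hT
  set t := √(T : ℝ) with ht
  set x := √d with hx
  have ht2 : t ^ 2 = T := Real.sq_sqrt (by positivity)
  have hx2 : x ^ 2 = d := Real.sq_sqrt (by positivity)
  have ht0 : 0 < t := Real.sqrt_pos.2 (by exact_mod_cast hT0)
  have hd4 : 4 * (T : ℝ) ≤ d := by rw [hd]; exact_mod_cast hι
  have hxt : 2 * t ≤ x := by
    refine le_of_sq_le_sq ?_ (Real.sqrt_nonneg _)
    rw [mul_pow, ht2, hx2]
    linarith
  have hx0 : 0 < x := by linarith
  -- The value that balances `K / ρ` and `d * ρ`.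
  set ρ : ℝ := 0.9 * t / x with hρ
  have hρ0 : 0 < ρ := by positivity
  set l : ℝ := ρ / (1 + 2 * ρ) with hl'
  have hl0 : 0 < l := by positivity
  have h12 : 1 - 2 * l = (1 + 2 * ρ)⁻¹ := by
    rw [hl']
    field_simp
    ring
  have hl : l < 1 / 2 := by
    have : 0 < 1 - 2 * l := by
      rw [h12]
      positivity
    linarith
  refine ⟨fun y => 4 / (3 * l) * (normPartition l y + (K - 1 - d / 2 * Real.log (1 - 2 * l)))
    - 1 / 3 * (sqNorm y / T), _, (((hasMean_normPartition hT0 hl).add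
      (hasMean_const _)).const_mul _).sub ((hasMean_sqNorm_div hT0).const_mul _), ?_, ?_⟩
  · have hlog : - Real.log (1 - 2 * l) ≤ 2 * ρ * (1 + ρ) / (1 + 2 * ρ) := by
      rw [h12, Real.log_inv, neg_neg]
      refine (log_le_half_sub_inv (by linarith)).trans_eq ?_
      field_simp
      ring
    have h1 : 4 / (3 * l) * (1 + (K - 1 - d / 2 * Real.log (1 - 2 * l))) ≤
        4 / (3 * l) * (0.81 * t ^ 2 + d / 2 * (2 * ρ * (1 + ρ) / (1 + 2 * ρ))) := by
      have : d / 2 * (-Real.log (1 - 2 * l)) ≤ d / 2 * (2 * ρ * (1 + ρ) / (1 + 2 * ρ)) := by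
        gcongr
      refine mul_le_mul_of_nonneg_left ?_ (by positivity)
      rw [ht2]
      linarith
    have h2 : 4 / (3 * l) * (0.81 * t ^ 2 + d / 2 * (2 * ρ * (1 + ρ) / (1 + 2 * ρ))) - 1 / 3 * d =
        x ^ 2 + 2.4 * x * t + 2.16 * t ^ 2 := by
      rw [hl', ← hx2, hρ]
      field_simp
      ring
    nlinarith [mul_nonneg ht0.le (sub_nonneg.2 hxt)]
  · intro y u hu
    have h1 := (Real.add_one_le_exp _).trans (exp_le_normPartition hT0 hl y hu)
    have h2 : sqNorm ((toMat y).mulVec u) = 4 / (3 * l) * (l * (3 / 4 * sqNorm ((toMat y).mulVec u)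
        + 1 / 4 * (sqNorm y / T))) - 1 / 3 * (sqNorm y / T) := by
      field_simp
      ring
    rw [h2]
    refine sub_le_sub_right (mul_le_mul_of_nonneg_left ?_ (by positivity)) _
    linarith

/-- An integrable lower bound for the smallest singular value of a standard Gaussian matrix with
sufficiently many more rows than columns. -/
theorem exists_hasMean_le_sqrt_sqNorm (hT : 2 ≤ T)
    (hι : 2.4 * √(T : ℝ) ≤ √(Fintype.card ι : ℝ)) :
    ∃ (f : (ι × Fin T → ℝ) → ℝ) (c : ℝ), HasMean (stdGauss (ι × Fin T)) f c ∧
      √(Fintype.card ι : ℝ) - 2.15 * √(T : ℝ) ≤ c ∧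
      ∀ (y : ι × Fin T → ℝ) (u : Fin T → ℝ), sqNorm u = 1 →
        f y ≤ √(sqNorm ((toMat y).mulVec u)) := by
  have hT0 : 0 < T := by omega
  have hT2 : (2 : ℝ) ≤ T := by exact_mod_cast hT
  set d : ℝ := (Fintype.card ι : ℝ) with hd
  set K := entropyBound T with hK
  have hKT := entropyBound_le hT
  set t := √(T : ℝ) with ht
  set x := √d with hx
  have ht2 : t ^ 2 = T := Real.sq_sqrt (by positivity)
  have hx2 : x ^ 2 = d := Real.sq_sqrt (by positivity)
  have ht0 : 0 < t := Real.sqrt_pos.2 (by exact_mod_cast hT0)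
  have hx0 : 0 < x := by linarith
  clear_value x t
  have hxt : 0 < x - 0.9 * t := by linarith
  set b : ℝ := x - 1.4 * t with hb
  have hb0 : 0 < b := by linarith
  -- The maximiser of `d / (1 + l) - 0.81 * T / l`.
  set l : ℝ := 0.9 * t / (x - 0.9 * t) with hl'
  have hl0 : 0 < l := by positivity
  have hl : -l < 1 / 2 := by linarith
  -- The standard deviation of `sqNorm y / T`.
  set r : ℝ := √2 * x / t with hr
  have hr0 : 0 < r := by positivity
  have hr2 : r ^ 2 = 2 * d / T := by
    rw [hr, div_pow, mul_pow, Real.sq_sqrt (by norm_num), hx2, ht2]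
  have hlog : x ^ 2 - 0.9 * t * x ≤ d / (2 * l) * Real.log (1 - 2 * -l) := by
    have h1 := Real.le_log_one_add_of_nonneg (x := 2 * l) (by positivity)
    rw [show 1 - 2 * -l = 1 + 2 * l by ring]
    calc x ^ 2 - 0.9 * t * x = d / (2 * l) * (2 * (2 * l) / (2 * l + 2)) := by
          rw [hl', ← hx2]
          field_simp
          ring
      _ ≤ _ := by gcongr
  have hKl : K / l ≤ 0.9 * t * (x - 0.9 * t) := by
    rw [div_le_iff₀ hl0, hl']
    refine hKT.trans_eq ?_
    rw [← ht2, mul_assoc, mul_div_cancel₀ _ hxt.ne']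
    ring
  -- With this `b`, only the fluctuations of `normPartition` and of `sqNorm y / T` remain in the
  -- upper bound for `b ^ 2 - ‖F u‖²`.
  have hdet : 3 / 4 * b ^ 2 + 1 / 4 * d + K / l - d / (2 * l) * Real.log (1 - 2 * -l) ≤ 0 := by
    rw [← hx2, hb] at *
    nlinarith [mul_nonneg ht0.le (sub_nonneg.2 hι)]
  clear_value l r b
  set R : (ι × Fin T → ℝ) → ℝ := fun y => 4 / 3 * (1 / (Real.exp 1 * l) * normPartition (-l) y +
    1 / 4 * (1 / 2 * (sqNorm y / T - d) + 1 / (4 * r) * (sqNorm y / T - d) ^ 2 + r / 4)) with hR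
  have hRmean := (((hasMean_normPartition (ι := ι) hT0 hl).const_mul (1 / (Real.exp 1 * l))).add
    ((((((hasMean_sqNorm_div (ι := ι) hT0).sub (hasMean_const d)).const_mul (1 / 2)).add
    ((hasMean_sqNorm_div_sub_sq (ι := ι) hT0).const_mul (1 / (4 * r)))).add
    (hasMean_const (r / 4))).const_mul (1 / 4))).const_mul (4 / 3)
  refine ⟨fun y => b - b⁻¹ * R y, _, (hasMean_const b).sub (hRmean.const_mul b⁻¹), ?_, ?_⟩
  · rw [← hd, ← hr2]
    have h1 : 4 / 3 * (1 / (Real.exp 1 * l) * 1 +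
        1 / 4 * (1 / 2 * (d - d) + 1 / (4 * r) * r ^ 2 + r / 4)) ≤ 0.75 * t * b := by
      have h2 : 1 / (Real.exp 1 * l) * 1 ≤ 0.368 * (1 / l) := by
        have he : 1 / Real.exp 1 ≤ 0.368 := by
          rw [div_le_iff₀ (Real.exp_pos 1)]
          have := Real.exp_one_gt_d9
          linarith
        rw [mul_one, ← one_div_mul_one_div]
        gcongr
      have h3 : 1 / l = 10 / 9 * (x / t) - 1 := by
        rw [hl']
        field_simp
        ring
      have h4 : r ≤ 1.415 * (x / t) := by
        rw [hr, mul_div_assoc]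
        gcongr
        rw [Real.sqrt_le_left (by norm_num)]
        norm_num
      have h5 : 1 / (4 * r) * r ^ 2 = r / 4 := by field_simp
      rw [h5]
      set q := x / t with hq
      have hqx : x = q * t := by rw [hq]; field_simp
      have hq24 : 2.4 ≤ q := by rw [hq, le_div_iff₀ ht0]; exact hι
      have h7 : 0.75 * t * b = 0.75 * T * (q - 1.4) := by
        rw [hb, hqx, ← ht2]
        ring
      rw [h7]
      have h8 : 0.75 * 2 * (q - 1.4) ≤ 0.75 * T * (q - 1.4) := by
        have : 0 ≤ q - 1.4 := by linarith
        gcongr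
      refine le_trans ?_ h8
      rw [h3] at h2
      clear_value q
      linarith only [h2, h4, hq24]
    have h8 := mul_le_mul_of_nonneg_left h1 (inv_nonneg.2 hb0.le)
    have h9 : b⁻¹ * (0.75 * t * b) = 0.75 * t := by field_simp
    rw [h9] at h8
    linarith
  · intro y u hu
    clear hRmean
    set v := sqNorm ((toMat y).mulVec u) with hv
    have hv0 : 0 ≤ v := sqNorm_nonneg _
    set Y := -l * (3 / 4 * v + 1 / 4 * (sqNorm y / T)) - K + d / 2 * Real.log (1 - 2 * -l) with hY
    -- `Y ≤ exp (Y - 1)`, and `exp Y` has mean at most one.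
    have hYe : Y ≤ 1 / Real.exp 1 * normPartition (-l) y := by
      have h1 := Real.add_one_le_exp (Y - 1)
      have h2 := exp_le_normPartition hT0 hl y hu
      rw [Real.exp_sub] at h1
      rw [one_div_mul_eq_div]
      refine le_trans (by linarith) (h1.trans ?_)
      gcongr
    have hQ0 : 0 ≤ normPartition (-l) y :=
      (Real.exp_nonneg _).trans (exp_le_normPartition hT0 hl y hu)
    set D := sqNorm y / T - d with hD
    have hDr : 1 / 2 * |D| ≤ 1 / (4 * r) * D ^ 2 + r / 4 := by
      have h1 : 1 / (4 * r) * D ^ 2 + r / 4 - 1 / 2 * |D| = 1 / (4 * r) * (|D| - r) ^ 2 := by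
        rw [← sq_abs D]
        field_simp
        ring
      have h2 : 0 ≤ 1 / (4 * r) * (|D| - r) ^ 2 := by positivity
      linarith
    have hRy : R y = 4 / 3 * (1 / (Real.exp 1 * l) * normPartition (-l) y +
      1 / 4 * (1 / 2 * D + 1 / (4 * r) * D ^ 2 + r / 4)) := rfl
    have hD1 := le_abs_self D
    have hD2 := neg_abs_le D
    have hR0 : 0 ≤ R y := by
      have : 0 ≤ 1 / (Real.exp 1 * l) * normPartition (-l) y := by positivity
      rw [hRy]
      linarith
    have hbv : b ^ 2 - v ≤ R y := by
      have h1 : Y / l = -(3 / 4 * v + 1 / 4 * (D + d)) - K / l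
          + d / (2 * l) * Real.log (1 - 2 * -l) := by
        rw [hY, hD]
        generalize Real.log (1 - 2 * -l) = L
        field_simp
        ring
      have h2 : Y / l ≤ 1 / (Real.exp 1 * l) * normPartition (-l) y := by
        rw [div_le_iff₀ hl0]
        refine hYe.trans_eq ?_
        field_simp
      rw [hRy]
      linarith
    have hvs : √v ^ 2 = v := Real.sq_sqrt hv0
    have hvn : 0 ≤ √v := Real.sqrt_nonneg v
    -- From `b² - v ≤ R` to `√v ≥ b - R / b`.
    change b - b⁻¹ * R y ≤ √v
    rcases le_total b (√v) with h | h
    · have : 0 ≤ b⁻¹ * R y := by positivity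
      linarith
    · have h3 : b * (b - √v) ≤ R y := by
        have := mul_nonneg hvn (sub_nonneg.2 h)
        linarith only [this, hbv, hvs]
      have h4 : b - √v ≤ b⁻¹ * R y := by
        rw [inv_mul_eq_div, le_div_iff₀ hb0]
        linarith only [h3]
      linarith only [h4]

end Uniform

/-! ### Singular values of the donor pools -/

section Transfer

variable {Ω Ω' : Type*} [MeasurableSpace Ω] [MeasurableSpace Ω'] {P : Measure Ω} {Q : Measure Ω'}

lemma HasMean.comp {f : Ω' → ℝ} {a : ℝ} (hf : HasMean Q f a) {X : Ω → Ω'} (hX : HasLaw X Q P) :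
    HasMean P (fun ω => f (X ω)) a := by
  refine ⟨?_, ?_⟩
  · have h := hf.1
    rw [← hX.map_eq] at h
    exact h.comp_aemeasurable hX.aemeasurable
  · rw [← hf.2]
    exact hX.integral_comp hf.1.aestronglyMeasurable

end Transfer

section Euclidean

variable {ι : Type*} [Fintype ι] {n T : ℕ}

lemma norm_sq_eq_sqNorm (v : EuclideanSpace ℝ ι) : ‖v‖ ^ 2 = sqNorm v.ofLp := by
  rw [EuclideanSpace.real_norm_sq_eq, sqNorm]

lemma norm_toEuclideanLin_sq (Z : Matrix ι (Fin T) ℝ) (u : EuclideanSpace ℝ (Fin T)) :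
    ‖Matrix.toEuclideanLin Z u‖ ^ 2 = sqNorm (Z.mulVec u.ofLp) := by
  rw [norm_sq_eq_sqNorm, Matrix.ofLp_toLpLin, Matrix.toLin'_apply]

/-- A matrix with orthonormal rows does not increase the norm. -/
lemma sqNorm_mulVec_le_of_mul_transpose {κ : Type*} [Fintype κ] [DecidableEq κ]
    {W : Matrix κ ι ℝ} (hW : W * W.transpose = 1) (v : ι → ℝ) :
    sqNorm (W.mulVec v) ≤ sqNorm v := by
  have h1 := sqNorm_nonneg (v - W.transpose.mulVec (W.mulVec v))
  have h2 : W.transpose.mulVec (W.mulVec v) ⬝ᵥ v = sqNorm (W.mulVec v) := by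
    rw [Matrix.mulVec_transpose, ← Matrix.dotProduct_mulVec, sqNorm]
    simp [dotProduct, sq]
  have h3 : sqNorm (W.transpose.mulVec (W.mulVec v)) = sqNorm (W.mulVec v) := by
    have : W.transpose.mulVec (W.mulVec v) ⬝ᵥ W.transpose.mulVec (W.mulVec v) =
        W.mulVec v ⬝ᵥ W.mulVec v := by
      rw [Matrix.dotProduct_mulVec, Matrix.vecMul_transpose, Matrix.mulVec_mulVec, hW,
        Matrix.one_mulVec]
    simpa [sqNorm, dotProduct, sq] using this
  have h4 : sqNorm (v - W.transpose.mulVec (W.mulVec v)) = sqNorm v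
      - 2 * (W.transpose.mulVec (W.mulVec v) ⬝ᵥ v)
      + sqNorm (W.transpose.mulVec (W.mulVec v)) := by
    simp only [sqNorm, dotProduct, Pi.sub_apply, Finset.mul_sum, ← Finset.sum_sub_distrib,
      ← Finset.sum_add_distrib]
    exact Finset.sum_congr rfl fun i _ => by ring
  rw [h2, h3] at h4
  linarith

/-- The orthogonal projection onto the complement of the column space, in coordinates. -/
lemma exists_orthonormal_rows_mul_eq_zero (M : Matrix (Fin n) (Fin T) ℝ) :
    ∃ (N : ℕ) (W : Matrix (Fin N) (Fin n) ℝ), N + M.rank = n ∧ W * W.transpose = 1 ∧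
      W * M = 0 := by
  set V := (LinearMap.range (Matrix.toEuclideanLin M))ᗮ with hV
  let b := stdOrthonormalBasis ℝ V
  refine ⟨Module.finrank ℝ V, Matrix.of fun i j => (b i : EuclideanSpace ℝ (Fin n)).ofLp j,
    ?_, ?_, ?_⟩
  · have h := Submodule.finrank_add_finrank_orthogonal (LinearMap.range (Matrix.toEuclideanLin M))
    rw [finrank_range_toEuclideanLin, finrank_euclideanSpace_fin, add_comm] at h
    exact h
  · ext i k
    have h := orthonormal_iff_ite.1 b.orthonormal k i
    rw [Submodule.coe_inner, EuclideanSpace.inner_eq_star_dotProduct] at h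
    rw [star_trivial, if_congr eq_comm rfl rfl] at h
    rw [Matrix.one_apply]
    exact h
  · ext i t
    have hmem : Matrix.toEuclideanLin M (EuclideanSpace.single t 1) ∈
        LinearMap.range (Matrix.toEuclideanLin M) := ⟨_, rfl⟩
    have h := Submodule.inner_right_of_mem_orthogonal hmem (b i).2
    rw [EuclideanSpace.inner_eq_star_dotProduct] at h
    rw [star_trivial, Matrix.ofLp_toLpLin, Matrix.toLin'_apply] at h
    simpa [Matrix.mul_apply, dotProduct] using h

/-- Multiplication from the left by a matrix with orthonormal rows maps a standard Gaussian matrix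
to a standard Gaussian matrix. -/
lemma exists_hasLaw_mul_toMat {N : ℕ} {W : Matrix (Fin N) (Fin n) ℝ} (hW : W * W.transpose = 1) :
    ∃ L : (Fin n × Fin T → ℝ) → (Fin N × Fin T → ℝ),
      HasLaw L (stdGauss (Fin N × Fin T)) (stdGauss (Fin n × Fin T)) ∧
      ∀ y, toMat (L y) = W * toMat y := by
  let A : Matrix (Fin N × Fin T) (Fin n × Fin T) ℝ :=
    Matrix.kroneckerMap (· * ·) W (1 : Matrix (Fin T) (Fin T) ℝ)
  have hA : A * A.transpose = 1 := by
    simp only [A]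
    rw [← Matrix.kroneckerMap_transpose, Matrix.transpose_one, ← Matrix.mul_kronecker_mul, hW,
      one_mul, Matrix.one_kronecker_one]
  refine ⟨fun y => A.mulVec y, ⟨Continuous.aemeasurable (by fun_prop), map_mulVec_stdGauss A hA⟩,
    fun y => ?_⟩
  ext i t
  change ∑ q : Fin n × Fin T, W i q.1 * (1 : Matrix (Fin T) (Fin T) ℝ) t q.2 * y q =
    ∑ j, W i j * y (j, t)
  rw [Fintype.sum_prod_type]
  exact Finset.sum_congr rfl fun j _ => by simp [Matrix.one_apply]

end Euclidean

section Pools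

variable {n T : ℕ} {s : ℝ}

lemma rank_subPool_le (C : Finset (Fin n)) (M : Matrix (Fin n) (Fin T) ℝ) :
    (subPool C M).rank ≤ M.rank :=
  Matrix.rank_submatrix_le M _ _

lemma sqNorm_subPool_mulVec_le (C : Finset (Fin n)) (Z : Matrix (Fin n) (Fin T) ℝ)
    (v : Fin T → ℝ) : sqNorm ((subPool C Z).mulVec v) ≤ sqNorm (Z.mulVec v) := by
  have h : sqNorm ((subPool C Z).mulVec v) = ∑ i ∈ C, (Z.mulVec v i) ^ 2 := by
    rw [← Finset.sum_coe_sort C]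
    rfl
  rw [h]
  exact Finset.sum_le_sum_of_subset_of_nonneg (Finset.subset_univ C) fun _ _ _ => sq_nonneg _

lemma sigmaStar_add_sq_le {ι : Type*} [Fintype ι] (S N : Matrix ι (Fin T) ℝ) (hS : S.rank < T) :
    ∃ w : Fin T → ℝ, sqNorm w = 1 ∧ sigmaStar S (S + N) ^ 2 ≤ sqNorm (N.mulVec w) := by
  obtain ⟨w, hw, h⟩ := exists_sigmaStar_add_le S N hS
  refine ⟨w.ofLp, by rw [← norm_sq_eq_sqNorm, hw, one_pow], ?_⟩
  rw [← norm_toEuclideanLin_sq]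
  exact pow_le_pow_left₀ (sigmaStar_nonneg _ _) h 2

lemma sigmaStar_subPool_sq_le (C : Finset (Fin n)) (M N : Matrix (Fin n) (Fin T) ℝ)
    (hM : M.rank < T) : ∃ w : Fin T → ℝ, sqNorm w = 1 ∧
      sigmaStar (subPool C M) (subPool C (M + N)) ^ 2 ≤ sqNorm (N.mulVec w) := by
  obtain ⟨w, hw, h⟩ := sigmaStar_add_sq_le (subPool C M) (subPool C N)
    ((rank_subPool_le C M).trans_lt hM)
  exact ⟨w, hw, h.trans (sqNorm_subPool_mulVec_le C N w)⟩

/-- The part of the noise orthogonal to the column space of the signal bounds `σ_{rank M + 1}` from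
below. -/
lemma exists_sqrt_sqNorm_le_sigmaStar {N : ℕ} {W : Matrix (Fin N) (Fin n) ℝ}
    (hW : W * W.transpose = 1) {M : Matrix (Fin n) (Fin T) ℝ} (hWM : W * M = 0)
    (hM : M.rank < T) (Z : Matrix (Fin n) (Fin T) ℝ) :
    ∃ u : Fin T → ℝ, sqNorm u = 1 ∧ √(sqNorm ((W * Z).mulVec u)) ≤ sigmaStar M (M + Z) := by
  obtain ⟨u, hu, h⟩ := exists_norm_eq_sigmaStar M (M + Z) hM
  refine ⟨u.ofLp, by rw [← norm_sq_eq_sqNorm, hu, one_pow], ?_⟩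
  refine Real.sqrt_le_iff.2 ⟨sigmaStar_nonneg _ _, ?_⟩
  rw [← h, norm_toEuclideanLin_sq]
  have h1 : W * Z = W * (M + Z) := by rw [Matrix.mul_add, hWM, zero_add]
  rw [h1, ← Matrix.mulVec_mulVec]
  exact sqNorm_mulVec_le_of_mul_transpose hW _

lemma sqNorm_smul_mulVec {ι : Type*} [Fintype ι] (c : ℝ) (F : Matrix ι (Fin T) ℝ)
    (u : Fin T → ℝ) : sqNorm ((c • F).mulVec u) = c ^ 2 * sqNorm (F.mulVec u) := by
  rw [Matrix.smul_mulVec, sqNorm_smul]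

/-- An integrable lower bound for `σ_{rank M + 1}` of the noisy full pool. -/
lemma exists_hasMean_le_sigmaStar (hT : 2 ≤ T) (hs : 0 < s) (M : Matrix (Fin n) (Fin T) ℝ)
    (hM : M.rank < T) : ∃ (f : (Fin n × Fin T → ℝ) → ℝ) (c : ℝ),
      HasMean (stdGauss (Fin n × Fin T)) f c ∧ √(n : ℝ) - 2.6 * √(T : ℝ) ≤ c ∧
      ∀ y, s * f y ≤ sigmaStar M (M + s • toMat y) := by
  -- For small `n / T` the claimed bound is not positive.
  rcases le_total (√(n : ℝ)) (2.6 * √(T : ℝ)) with h | h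
  · exact ⟨fun _ => 0, 0, hasMean_const 0, by linarith,
      fun y => by simpa using sigmaStar_nonneg _ _⟩
  obtain ⟨N, W, hN, hW, hWM⟩ := exists_orthonormal_rows_mul_eq_zero M
  obtain ⟨L, hL, hLy⟩ := exists_hasLaw_mul_toMat (T := T) hW
  have hNn : (n : ℝ) ≤ N + T := by exact_mod_cast (by omega : n ≤ N + T)
  have ht0 : 0 < √(T : ℝ) := Real.sqrt_pos.2 (by exact_mod_cast (by omega : 0 < T))
  have ht2 : √(T : ℝ) ^ 2 = T := Real.sq_sqrt (by positivity)
  have hn2 : √(n : ℝ) ^ 2 = n := Real.sq_sqrt (by positivity)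
  have hN2 : √(N : ℝ) ^ 2 = N := Real.sq_sqrt (by positivity)
  have hNN := Real.sqrt_nonneg (N : ℝ)
  have hNT : 2.4 * √(T : ℝ) ≤ √(N : ℝ) := by
    refine le_of_sq_le_sq ?_ hNN
    nlinarith
  have hnN : √(n : ℝ) ≤ √(N : ℝ) + 0.25 * √(T : ℝ) := by
    refine le_of_sq_le_sq ?_ (by positivity)
    nlinarith
  obtain ⟨f, c, hf, hc, hfu⟩ := exists_hasMean_le_sqrt_sqNorm (ι := Fin N) hT (by simpa using hNT)
  rw [Fintype.card_fin] at hc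
  refine ⟨fun y => f (L y), c, hf.comp hL, by linarith, fun y => ?_⟩
  obtain ⟨u, hu, h1⟩ := exists_sqrt_sqNorm_le_sigmaStar hW hWM hM (s • toMat y)
  refine le_trans ?_ h1
  rw [Matrix.mul_smul, ← hLy, sqNorm_smul_mulVec, Real.sqrt_mul (by positivity),
    Real.sqrt_sq hs.le]
  exact mul_le_mul_of_nonneg_left (hfu _ u hu) hs.le

lemma sqTerm_nonneg {ι : Type*} [Fintype ι] (s : ℝ) (S Z : Matrix ι (Fin T) ℝ) :
    0 ≤ sqTerm s S Z := sq_nonneg _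

lemma continuous_sqTerm {ι : Type*} [Fintype ι] (S : Matrix ι (Fin T) ℝ) (hS : S.rank < T) :
    Continuous fun Z : Matrix ι (Fin T) ℝ => sqTerm s S Z := by
  unfold sqTerm
  exact ((continuous_sigmaStar S hS).add continuous_const).pow 2

end Pools

/-! ### Comparison of the two bounds -/

section Main

variable {Ω : Type*} [MeasurableSpace Ω] {P : Measure Ω} {n T : ℕ}
  {s : ℝ} {M : Matrix (Fin n) (Fin T) ℝ} {E : Ω → Matrix (Fin n) (Fin T) ℝ}
  {C : Ω → Finset (Fin n)}

lemma smul_toMat_inv_mul (hs : 0 < s) (Z : Matrix (Fin n) (Fin T) ℝ) :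
    s • toMat (fun p : Fin n × Fin T => s⁻¹ * Z p.1 p.2) = Z := by
  ext i t
  simp [toMat, hs.ne']

lemma aestronglyMeasurable_sqTerm (hM : M.rank < T) (hE : ∀ i t, AEMeasurable (fun ω => E ω i t) P)
    (B : Finset (Fin n)) :
    AEStronglyMeasurable (fun ω => sqTerm s (subPool B M) (subPool B (M + E ω))) P := by
  have h1 : AEMeasurable (fun ω (i : Fin n) (t : Fin T) => E ω i t) P :=
    aemeasurable_pi_lambda _ fun i => aemeasurable_pi_lambda _ fun t => hE i t
  have h2 : Continuous fun Z : Fin n → Fin T → ℝ => subPool B (M + Matrix.of Z) := by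
    unfold subPool
    exact (continuous_const.add (continuous_id : Continuous fun Z : Fin n → Fin T → ℝ =>
      Matrix.of Z)).matrix_submatrix _ _
  exact (((continuous_sqTerm (s := s) (subPool B M)
    ((rank_subPool_le B M).trans_lt hM)).comp h2).measurable.comp_aemeasurable
      h1).aestronglyMeasurable

lemma aestronglyMeasurable_sqTerm_full (hM : M.rank < T)
    (hE : ∀ i t, AEMeasurable (fun ω => E ω i t) P) :
    AEStronglyMeasurable (fun ω => sqTerm s M (M + E ω)) P := by
  have h1 : AEMeasurable (fun ω (i : Fin n) (t : Fin T) => E ω i t) P :=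
    aemeasurable_pi_lambda _ fun i => aemeasurable_pi_lambda _ fun t => hE i t
  have h2 : Continuous fun Z : Fin n → Fin T → ℝ => M + Matrix.of Z :=
    continuous_const.add (continuous_id : Continuous fun Z : Fin n → Fin T → ℝ => Matrix.of Z)
  exact (((continuous_sqTerm (s := s) M hM).comp h2).measurable.comp_aemeasurable
      h1).aestronglyMeasurable

lemma aestronglyMeasurable_sqTerm_cluster (hM : M.rank < T)
    (hE : ∀ i t, AEMeasurable (fun ω => E ω i t) P)
    (hC : ∀ B : Finset (Fin n), MeasurableSet {ω | C ω = B}) :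
    AEStronglyMeasurable (fun ω => sqTerm s (subPool (C ω) M) (subPool (C ω) (M + E ω))) P := by
  classical
  have h : (fun ω => sqTerm s (subPool (C ω) M) (subPool (C ω) (M + E ω))) = fun ω =>
      ∑ B : Finset (Fin n), {ω | C ω = B}.indicator
        (fun ω => sqTerm s (subPool B M) (subPool B (M + E ω))) ω := by
    ext ω
    rw [Finset.sum_eq_single (C ω)]
    · simp
    · intro B _ hB
      simp [Ne.symm hB]
    · simp
  rw [h]
  exact Finset.aestronglyMeasurable_fun_sum _ fun B _ =>
    (aestronglyMeasurable_sqTerm hM hE B).indicator (hC B)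

variable [IsProbabilityMeasure P]

/-- The normalised noise is a standard Gaussian matrix. -/
lemma hasLaw_stdGauss (hs : 0 < s)
    (hE : ∀ i t, HasLaw (fun ω => E ω i t) (gaussianReal 0 (Real.toNNReal (s ^ 2))) P)
    (hind : iIndepFun (fun (p : Fin n × Fin T) (ω : Ω) => E ω p.1 p.2) P) :
    HasLaw (fun ω (p : Fin n × Fin T) => s⁻¹ * E ω p.1 p.2) (stdGauss (Fin n × Fin T)) P := by
  have h1 : ∀ p : Fin n × Fin T,
      HasLaw (fun ω => s⁻¹ * E ω p.1 p.2) (gaussianReal 0 1) P := by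
    intro p
    have h := gaussianReal_const_mul (hE p.1 p.2) s⁻¹
    convert h using 2
    · simp
    · ext
      simp [Real.coe_toNNReal _ (sq_nonneg s), hs.ne']
  have h2 : iIndepFun (fun (p : Fin n × Fin T) (ω : Ω) => s⁻¹ * E ω p.1 p.2) P :=
    hind.comp (fun _ x => s⁻¹ * x) fun _ => by fun_prop
  refine ⟨aemeasurable_pi_lambda _ fun p => (h1 p).aemeasurable, ?_⟩
  rw [(iIndepFun_iff_map_fun_eq_pi_map fun p => (h1 p).aemeasurable).1 h2]
  simp_rw [(h1 _).map_eq]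

/-- The comparison of the two mean squares when `2 s (√n_A + √T)` is at most `s b` almost surely:
both are finite, and they are compared through `E σ*_X ≥ s (√n - 2.6 √T)` and
`E (σ*_A)² ≤ s² (√n + 4/3 √T)²`. -/
lemma integrable_and_gap (hT : 2 ≤ T) (hn : 4 * T ≤ n) (hs : 0 < s) (hM : M.rank < T)
    (hE : ∀ i t, HasLaw (fun ω => E ω i t) (gaussianReal 0 (Real.toNNReal (s ^ 2))) P)
    (hind : iIndepFun (fun (p : Fin n × Fin T) (ω : Ω) => E ω p.1 p.2) P)
    (hC : ∀ B : Finset (Fin n), MeasurableSet {ω | C ω = B}) {b : ℝ}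
    (hb : b ≤ 2 * (√(n : ℝ) - √(T : ℝ)))
    (hCb : ∀ᵐ ω ∂P, 2 * (√((C ω).card : ℝ) + √(T : ℝ)) ≤ b) :
    Integrable (fun ω => sqTerm s M (M + E ω)) P ∧
    Integrable (fun ω => sqTerm s (subPool (C ω) M) (subPool (C ω) (M + E ω))) P ∧
    s ^ 2 * ((2 * (√(n : ℝ) + √(T : ℝ)) - b) * √(n : ℝ) / 30) ≤
      ∫ ω, sqTerm s M (M + E ω) ∂P
        - ∫ ω, sqTerm s (subPool (C ω) M) (subPool (C ω) (M + E ω)) ∂P := by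
  set G : Ω → Fin n × Fin T → ℝ := fun ω p => s⁻¹ * E ω p.1 p.2 with hGdef
  have hG : HasLaw G (stdGauss (Fin n × Fin T)) P := hasLaw_stdGauss hs hE hind
  have hEG : ∀ ω, E ω = s • toMat (G ω) := fun ω => (smul_toMat_inv_mul hs (E ω)).symm
  have hEm : ∀ i t, AEMeasurable (fun ω => E ω i t) P := fun i t => (hE i t).aemeasurable
  obtain ⟨f, c, hf, hc, hfσ⟩ := exists_hasMean_le_sigmaStar hT hs M hM
  obtain ⟨g, d, hg, hd, hgu⟩ := exists_hasMean_sqNorm_le (ι := Fin n) hT (by simpa using hn)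
  rw [Fintype.card_fin] at hd
  replace hf := hf.comp hG
  replace hg := hg.comp hG
  have hσX : ∀ ω, sigmaStar M (M + E ω) ^ 2 ≤ s ^ 2 * g (G ω) := by
    intro ω
    obtain ⟨w, hw, h⟩ := sigmaStar_add_sq_le M (E ω) hM
    refine h.trans ?_
    rw [hEG, sqNorm_smul_mulVec]
    exact mul_le_mul_of_nonneg_left (hgu _ w hw) (sq_nonneg s)
  have hσA : ∀ ω, sigmaStar (subPool (C ω) M) (subPool (C ω) (M + E ω)) ^ 2 ≤ s ^ 2 * g (G ω) := by
    intro ω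
    obtain ⟨w, hw, h⟩ := sigmaStar_subPool_sq_le (C ω) M (E ω) hM
    refine h.trans ?_
    rw [hEG, sqNorm_smul_mulVec]
    exact mul_le_mul_of_nonneg_left (hgu _ w hw) (sq_nonneg s)
  have hσX' : ∀ ω, s * f (G ω) ≤ sigmaStar M (M + E ω) := by
    intro ω
    rw [hEG]
    exact hfσ _
  set y := √(n : ℝ) with hy
  set t := √(T : ℝ) with ht
  have ht0 : 0 < t := Real.sqrt_pos.2 (by exact_mod_cast (by omega : 0 < T))
  have hty : 2 * t ≤ y := by
    refine le_of_sq_le_sq ?_ (Real.sqrt_nonneg _)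
    rw [mul_pow, ht, hy, Real.sq_sqrt (by positivity), Real.sq_sqrt (by positivity)]
    norm_num
    exact_mod_cast hn
  clear_value y t
  have hy0 : 0 < y := by linarith
  have hb0 : 0 ≤ b := by
    obtain ⟨ω, hω⟩ := hCb.exists
    exact le_trans (mul_nonneg zero_le_two (add_nonneg (Real.sqrt_nonneg _) ht0.le)) hω
  set U := y + 4 / 3 * t with hU
  have hU0 : 0 < U := by linarith
  -- The quadratic majorant of `(σ + s b)²`, tight at `σ = s U`.
  have hmaj : HasMean P (fun ω => (1 + b / U) * s ^ 2 * g (G ω) + s ^ 2 * (b * U + b ^ 2))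
      ((1 + b / U) * s ^ 2 * d + s ^ 2 * (b * U + b ^ 2)) :=
    (hg.const_mul _).add (hasMean_const _)
  have hA : ∀ᵐ ω ∂P, sqTerm s (subPool (C ω) M) (subPool (C ω) (M + E ω)) ≤
      (1 + b / U) * s ^ 2 * g (G ω) + s ^ 2 * (b * U + b ^ 2) := by
    filter_upwards [hCb] with ω hω
    have h1 := hσA ω
    have h0 := sigmaStar_nonneg (subPool (C ω) M) (subPool (C ω) (M + E ω))
    unfold sqTerm
    rw [Fintype.card_coe, ← ht]
    set σ := sigmaStar (subPool (C ω) M) (subPool (C ω) (M + E ω))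
    have h2 : (σ + 2 * s * (√((C ω).card : ℝ) + t)) ^ 2 ≤ (σ + s * b) ^ 2 := by
      refine pow_le_pow_left₀ (add_nonneg h0 (mul_nonneg (by linarith)
        (add_nonneg (Real.sqrt_nonneg _) ht0.le))) ?_ 2
      have := mul_le_mul_of_nonneg_left hω hs.le
      linarith
    have h3 : (σ + s * b) ^ 2 = (1 + b / U) * σ ^ 2 + s ^ 2 * (b * U + b ^ 2)
        - b / U * (σ - s * U) ^ 2 := by
      field_simp
      ring
    have h4 : 0 ≤ b / U * (σ - s * U) ^ 2 := by positivity
    have h5 : (1 + b / U) * σ ^ 2 ≤ (1 + b / U) * (s ^ 2 * g (G ω)) := by gcongr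
    linarith
  have hX : ∀ ω, sqTerm s M (M + E ω) ≤ 2 * s ^ 2 * g (G ω) + 8 * s ^ 2 * (y + t) ^ 2 := by
    intro ω
    have h1 := hσX ω
    unfold sqTerm
    rw [Fintype.card_fin, ← ht, ← hy]
    set σ := sigmaStar M (M + E ω)
    have h2 := sq_nonneg (σ - 2 * s * (y + t))
    linarith
  have hXmaj : HasMean P (fun ω => 2 * s ^ 2 * g (G ω) + 8 * s ^ 2 * (y + t) ^ 2) _ :=
    (hg.const_mul _).add (hasMean_const _)
  have iX : Integrable (fun ω => sqTerm s M (M + E ω)) P :=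
    hXmaj.1.mono' (aestronglyMeasurable_sqTerm_full hM hEm) (Filter.Eventually.of_forall fun ω => by
      rw [Real.norm_of_nonneg (sqTerm_nonneg _ _ _)]
      exact hX ω)
  have iA : Integrable (fun ω => sqTerm s (subPool (C ω) M) (subPool (C ω) (M + E ω))) P :=
    hmaj.1.mono' (aestronglyMeasurable_sqTerm_cluster hM hEm hC) (hA.mono fun ω h => by
      rw [Real.norm_of_nonneg (sqTerm_nonneg _ _ _)]
      exact h)
  refine ⟨iX, iA, ?_⟩
  have hIA : ∫ ω, sqTerm s (subPool (C ω) M) (subPool (C ω) (M + E ω)) ∂P ≤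
      s ^ 2 * (U + b) ^ 2 := by
    refine (integral_mono_ae iA hmaj.1 hA).trans ?_
    rw [hmaj.2]
    have h1 : (1 + b / U) * s ^ 2 * d ≤ (1 + b / U) * s ^ 2 * U ^ 2 := by gcongr
    have h2 : (1 + b / U) * s ^ 2 * U ^ 2 + s ^ 2 * (b * U + b ^ 2) = s ^ 2 * (U + b) ^ 2 := by
      field_simp
    linarith
  -- The tangent of `(σ + 2 s (√n + √T))²` at `σ = s (√n - 2.6 √T)`.
  set m := 3 * y - 0.6 * t with hm
  have hm0 : 0 < m := by linarith
  have hmin : HasMean P (fun ω => 2 * s ^ 2 * m * f (G ω)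
      + s ^ 2 * (2 * m * (2 * (y + t)) - m ^ 2)) _ :=
    (hf.const_mul _).add (hasMean_const _)
  have hIX : s ^ 2 * m ^ 2 ≤ ∫ ω, sqTerm s M (M + E ω) ∂P := by
    refine le_trans ?_ (integral_mono hmin.1 iX fun ω => ?_)
    · rw [hmin.2]
      have h1 : 2 * s ^ 2 * m * (y - 2.6 * t) ≤ 2 * s ^ 2 * m * c := by gcongr
      have h2 : 2 * s ^ 2 * m * (y - 2.6 * t) + s ^ 2 * (2 * m * (2 * (y + t)) - m ^ 2) =
          s ^ 2 * m ^ 2 := by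
        rw [hm]
        ring
      linarith
    · have h1 := hσX' ω
      unfold sqTerm
      rw [Fintype.card_fin, ← ht, ← hy]
      set σ := sigmaStar M (M + E ω)
      have h2 := sq_nonneg (σ + 2 * s * (y + t) - s * m)
      have h3 : 2 * s * m * (s * f (G ω)) ≤ 2 * s * m * σ := by gcongr
      simp only
      linarith
  have hfin : (2 * (y + t) - b) * y / 30 ≤ m ^ 2 - (U + b) ^ 2 := by
    have e : m ^ 2 - (U + b) ^ 2 = (m - U - b) * (m + U + b) := by ring
    -- `1 / 60 = 1 - (4 / 3 + 2.6) / 4`, and `2 (√n + √T) - b ≥ 4 √T`.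
    have h1 : (2 * (y + t) - b) / 60 ≤ m - U - b := by
      rw [hm, hU]
      linarith
    have h2 : 2 * y ≤ m + U + b := by
      rw [hm, hU]
      linarith
    have h3 : 0 ≤ (2 * (y + t) - b) / 60 := by
      apply div_nonneg _ (by norm_num)
      linarith
    have h4 := mul_le_mul h1 h2 (by positivity) (h3.trans h1)
    rw [e]
    linarith
  have := mul_le_mul_of_nonneg_left hfin (sq_nonneg s)
  linarith

lemma gap_le_scBound_sub_clusterBound {T₀ : ℕ} {μ δ : ℝ}
    (h : δ ≤ ∫ ω, sqTerm s M (M + E ω) ∂P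
        - ∫ ω, sqTerm s (subPool (C ω) M) (subPool (C ω) (M + E ω)) ∂P) :
    μ ^ 2 / T₀ * δ ≤ scBound P T₀ μ s M E - clusterBound P T₀ μ s M E C := by
  have h1 : ∫ ω, ((subPool (C ω) M).rank : ℝ) ∂P ≤ M.rank := by
    have := integral_mono_of_nonneg (μ := P) (f := fun ω => ((subPool (C ω) M).rank : ℝ))
      (g := fun _ => (M.rank : ℝ)) (Filter.Eventually.of_forall fun ω => Nat.cast_nonneg _)
      (integrable_const _)
      (Filter.Eventually.of_forall fun ω => Nat.cast_le.2 (rank_subPool_le (C ω) M))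
    simpa using this
  have h2 : 2 * s ^ 2 * (∫ ω, ((subPool (C ω) M).rank : ℝ) ∂P) / T₀ ≤
      2 * s ^ 2 * (M.rank : ℝ) / T₀ := by gcongr
  have h3 := mul_le_mul_of_nonneg_left h (by positivity : 0 ≤ μ ^ 2 / (T₀ : ℝ))
  unfold scBound clusterBound
  linarith

end Main

end ClusterSC

theorem theorem4p17 :
    ∃ c : ℝ, 0 < c ∧
      ∀ (Ω : Type*) [MeasurableSpace Ω] (P : Measure Ω) [IsProbabilityMeasure P]
        (n T T₀ : ℕ) (μ s : ℝ)
        (M : Matrix (Fin n) (Fin T) ℝ) (E : Ω → Matrix (Fin n) (Fin T) ℝ)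
        (C : Ω → Finset (Fin n)),
        0 < T₀ → T₀ < T → 4 * T ≤ n → 0 < μ → 0 < s → M.rank < T →
        (∀ i t, HasLaw (fun ω => E ω i t) (gaussianReal 0 (Real.toNNReal (s ^ 2))) P) →
        iIndepFun (fun (p : Fin n × Fin T) (ω : Ω) => E ω p.1 p.2) P →
        (∀ B : Finset (Fin n), MeasurableSet {ω | C ω = B}) →
        (∀ᵐ ω ∂P, ((C ω).card : ℝ) < n + 4 * T - 4 * √((n : ℝ) * T)) →
        Integrable (fun ω => ClusterSC.sqTerm s M (M + E ω)) P ∧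
        Integrable (fun ω => ClusterSC.sqTerm s (ClusterSC.subPool (C ω) M)
          (ClusterSC.subPool (C ω) (M + E ω))) P ∧
        ClusterSC.clusterBound P T₀ μ s M E C < ClusterSC.scBound P T₀ μ s M E ∧
        ∀ α : ℝ, 0 < α → α < 1 → (∀ᵐ ω ∂P, ((C ω).card : ℝ) ≤ α ^ 2 * n) →
          c * (1 - α) * (μ ^ 2 / T₀) * (s ^ 2 * n) ≤
            ClusterSC.scBound P T₀ μ s M E - ClusterSC.clusterBound P T₀ μ s M E C := by
  refine ⟨1 / 15, by norm_num, ?_⟩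
  intro Ω _ P _ n T T₀ μ s M E C hT₀ hT₀T hn hμ hs hM hE hind hC hcard
  have hT : 2 ≤ T := by omega
  have hT₀' : (0 : ℝ) < T₀ := by exact_mod_cast hT₀
  have ht0 : 0 < √(T : ℝ) := Real.sqrt_pos.2 (by exact_mod_cast (by omega : 0 < T))
  have ht2 : √(T : ℝ) ^ 2 = T := Real.sq_sqrt (by positivity)
  have hy2 : √(n : ℝ) ^ 2 = n := Real.sq_sqrt (by positivity)
  have hty : 2 * √(T : ℝ) ≤ √(n : ℝ) := by
    refine le_of_sq_le_sq ?_ (Real.sqrt_nonneg _)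
    rw [mul_pow, ht2, hy2]
    norm_num
    exact_mod_cast hn
  have hy0 : 0 < √(n : ℝ) := by linarith
  -- The condition on `n_A` says that `√n_A < √n - 2 √T`.
  have hb : ∀ᵐ ω ∂P, 2 * (√((C ω).card : ℝ) + √(T : ℝ)) ≤ 2 * (√(n : ℝ) - √(T : ℝ)) := by
    filter_upwards [hcard] with ω hω
    have h1 : √((C ω).card : ℝ) ≤ √(n : ℝ) - 2 * √(T : ℝ) := by
      rw [Real.sqrt_le_left (by linarith)]
      rw [Real.sqrt_mul (by positivity)] at hω
      nlinarith
    linarith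
  obtain ⟨h1, h2, h3⟩ := ClusterSC.integrable_and_gap hT hn hs hM hE hind hC le_rfl hb
  refine ⟨h1, h2, ?_, ?_⟩
  · have h4 := ClusterSC.gap_le_scBound_sub_clusterBound (T₀ := T₀) (μ := μ) h3
    have h5 : 0 < μ ^ 2 / T₀ * (s ^ 2 * ((2 * (√(n : ℝ) + √(T : ℝ))
        - 2 * (√(n : ℝ) - √(T : ℝ))) * √(n : ℝ) / 30)) := by
      have : 2 * (√(n : ℝ) + √(T : ℝ)) - 2 * (√(n : ℝ) - √(T : ℝ)) = 4 * √(T : ℝ) := by ring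
      rw [this]
      positivity
    linarith
  · intro α hα0 hα1 hα
    have hb' : ∀ᵐ ω ∂P, 2 * (√((C ω).card : ℝ) + √(T : ℝ)) ≤
        min (2 * (√(n : ℝ) - √(T : ℝ))) (2 * (α * √(n : ℝ) + √(T : ℝ))) := by
      filter_upwards [hb, hα] with ω h4 h5
      refine le_min h4 ?_
      have : √((C ω).card : ℝ) ≤ α * √(n : ℝ) := by
        rw [Real.sqrt_le_left (by positivity), mul_pow, hy2]
        exact h5
      linarith
    obtain ⟨-, -, h6⟩ := ClusterSC.integrable_and_gap hT hn hs hM hE hind hC (min_le_left _ _) hb'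
    refine le_trans ?_ (ClusterSC.gap_le_scBound_sub_clusterBound h6)
    have h7 : 1 / 15 * (1 - α) * n ≤ (2 * (√(n : ℝ) + √(T : ℝ))
        - min (2 * (√(n : ℝ) - √(T : ℝ))) (2 * (α * √(n : ℝ) + √(T : ℝ)))) * √(n : ℝ) / 30 := by
      have h8 : 2 * (1 - α) * √(n : ℝ) ≤ 2 * (√(n : ℝ) + √(T : ℝ))
          - min (2 * (√(n : ℝ) - √(T : ℝ))) (2 * (α * √(n : ℝ) + √(T : ℝ))) := by
        have := min_le_right (2 * (√(n : ℝ) - √(T : ℝ))) (2 * (α * √(n : ℝ) + √(T : ℝ)))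
        linarith
      have h9 := mul_le_mul_of_nonneg_right h8 hy0.le
      nlinarith
    calc 1 / 15 * (1 - α) * (μ ^ 2 / T₀) * (s ^ 2 * n)
        = μ ^ 2 / T₀ * (s ^ 2 * (1 / 15 * (1 - α) * n)) := by ring
      _ ≤ _ := by gcongr
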